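/- **Setting.** Let $q=(\theta,\varphi,x)\in\mathbb R^3$ and let $M,N:\mathbb R^3\to\mathbb R$ be smooth and positive. Consider the constraints $\phi_1=M(q)p_\theta$, $\phi_2=N(q)p_\varphi$, whose algebra $\{\phi_a,\phi_b\}=f_{ab}{}^c(q)\phi_c$ has the structure functions, antisymmetric in $a,b$, $f_{12}{}^1=N\,\partial_\varphi\ln M$ and $f_{12}{}^2=-M\,\partial_\theta\ln N$. Repeated indices are summed over $\{1,2\}$. The symmetrically ordered constraint operators are $\hat\phi_1=-i(M\partial_\theta+\tfrac12(\partial_\theta M))$, $\hat\phi_2=-i(N\partial_\varphi+\tfrac12(\partial_\varphi N))$. BRST wave functions $\Psi(q,\lambda,\bar\rho,\rho)$ are functions of $q\in\mathbb R^3$ and $\lambda\in\mathbb R^2$ with values in the complex Grassmann algebra generated by $\bar\rho_1,\bar\rho_2,\rho^1,\rho^2$. On them act $\hat C^a=-i\,\partial^\ell/\partial\bar\rho_a$, $\hat\pi_a=-i\,\partial/\partial\lambda^a$, multiplication by $\lambda^a,\bar\rho_a,\rho^a$, the BRST operator $$\hat\Omega=\big(\hat\phi_a-\tfrac i2 f_{ab}{}^b\big)\hat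 C^a+\tfrac12 f_{ab}{}^c\,\bar\rho_c\hat C^a\hat C^b-i\rho^a\hat\pi_a ,$$ and the gauge-fixing fermion $\hat\varrho$ with $i\hat\varrho=-\lambda^a\bar\rho_a$; $[\hat\Omega,\hat\varrho]=\hat\Omega\hat\varrho+\hat\varrho\hat\Omega$ is the graded commutator. For functions $\psi,\chi$ of $q$ alone (ghost-free, $\lambda$-independent states) the regularised BRST form is $$\langle\psi|\exp(i[\hat\Omega,\hat\varrho])\chi\rangle=-\int d^2\lambda\,d^3q\,d^2\bar\rho\,d^2\rho\;\psi^*\,\exp(i[\hat\Omega,\hat\varrho])\chi ,\qquad \int d^2\bar\rho\,d^2\rho\,\bar\rho_1\bar\rho_2\rho^1\rho^2=1 .$$ An exponential $\exp(tA)g$ is the classical ($C^1$, jointly in $t$ and all bosonic variables) solution $\Gamma_t$ of $\partial_t\Gamma_t=A\Gamma_t$, $\Gamma_0=g$, on all of $\mathbb R$; it is called well defined if this solution exists and is unique, and $\exp(A)g=\Gamma_1$. For $\exp(i\lambda^a\hat\phi_a)$ the multiplier $\lambda$ is a fixed parameter. Finally let $u$ be the $2\times2$ matrix $u^a{}_b(q,\lambda)=f_{cb}{}^a(q)\lambda^c$,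 and $$|j_0(u)|:=\det\Big[\frac{e^{u/2}-e^{-u/2}}{u}\Big],\qquad \frac{e^{u/2}-e^{-u/2}}{u}:=\sum_{k\ge0}\frac{u^{2k}}{4^k(2k+1)!}.$$ **Statement.** Suppose that the structure functions depend only on $x$. 1. (No completeness needed.) Let $\chi$ be smooth, and let $\Phi_t(q,\lambda)$, $t\in\mathbb R$, be a $C^1$ solution of $\partial_t\Phi_t=i\lambda^a\hat\phi_a\Phi_t$ with $\Phi_0=\chi$. Then there is a $C^1$ solution $\Psi_t$ of $\partial_t\Psi_t=i[\hat\Omega,\hat\varrho]\Psi_t$ with $\Psi_0=\chi$ such that for every $\psi:\mathbb R^3\to\mathbb C$ and at every $(q,\lambda)$: $-\int d^2\bar\rho\,d^2\rho\;\psi^*\Psi_1=|j_0(u)|\,\psi^*\,\Phi_1$. 2. Suppose that for every $\lambda\in\mathbb R^2$ the vector field $\lambda^1M\partial_\theta+\lambda^2N\partial_\varphi$ is complete. Then for all smooth $\psi,\chi:\mathbb R^3\to\mathbb C$ the exponentials $\exp(i[\hat\Omega,\hat\varrho])\chi$ and, for every $\lambda$, $\exp(i\lambda^a\hat\phi_a)\chi$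 are well defined; at every $(q,\lambda)$ $$-\int d^2\bar\rho\,d^2\rho\;\psi^*\exp(i[\hat\Omega,\hat\varrho])\chi=|j_0(u)|\,\psi^*\exp(i\lambda^a\hat\phi_a)\chi ;$$ one side is Lebesgue integrable over $(q,\lambda)\in\mathbb R^3\times\mathbb R^2$ if and only if the other is; and $$\langle\psi|\exp(i[\hat\Omega,\hat\varrho])\chi\rangle=\int d^2\lambda\,d^3q\;|j_0(u(x,\lambda))|\;\psi^*(q)\,\big[\exp(i\lambda^a\hat\phi_a)\chi\big](q)$$ (both integrals being given the value $0$ when they do not converge absolutely). 3. $|j_0(u)|$ is strictly positive and depends only on $(x,\lambda)$. At points where $f_{ab}{}^b=0$ for $a=1,2$ one has $|j_0(u)|=1$ for all $\lambda$. 4. At each point $q$ where $f_{ab}{}^b(q)\ne0$ for some $a$ (in particular, at every point, if the structure functions are constants of a non-unimodular Lie algebra), let $G$ be the gauge group in the adjoint representation, i.e. the subgroup of $GL(2,\mathbb R)$ generated by the exponentials $\exp(\lambda^a\,\mathrm{ad}\,T_a)=\exp(u(q,\lambda))$, where $[T_a,T_b]=f_{ab}{}^c(q)T_c$. Then $\lambda\mapsto\exp(u(q,\lambda))$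 is a bijection $\mathbb R^2\to G$, and it carries $|j_0(u)|\,d^2\lambda$ to the symmetric measure $\Delta^{1/2}d_Lg$ of $G$, where $d_Lg$ is a left Haar measure and $\Delta$ is the modular function of $G$ ($\Delta\,d_Lg$ is right invariant). -/

import Mathlib

open scoped ContDiff
open MeasureTheory

noncomputable section

namespace BRST

/-! ### Configuration space, multipliers, structure functions -/

/-- The configuration space `ℝ³`, with coordinates `q 0 = θ`, `q 1 = φ`, `q 2 = x`. -/
abbrev Conf := Fin 3 → ℝ

/-- The space `ℝ²` of the Lagrange multipliers, `l 0 = λ¹`, `l 1 = λ²`. -/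
abbrev Mult := Fin 2 → ℝ

/-- Partial derivative in the `i`-th coordinate. -/
def pd {n : ℕ} {F : Type*} [NormedAddCommGroup F] [NormedSpace ℝ F] (i : Fin n)
    (h : (Fin n → ℝ) → F) (q : Fin n → ℝ) : F :=
  fderiv ℝ h q (Pi.single i 1)

/-- The scaling functions of the two constraints `φ₁ = M p_θ` and `φ₂ = N p_φ`. -/
def scale (M N : Conf → ℝ) : Fin 2 → Conf → ℝ := ![M, N]

/-- The structure functions `f_{ab}^c` of `{φ_a, φ_b} = f_{ab}^c φ_c`: antisymmetric in `a, b`, with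
`f_{12}^1 = N ∂_φ (ln M)` and `f_{12}^2 = - M ∂_θ (ln N)`. -/
def structFn (M N : Conf → ℝ) (a b c : Fin 2) (q : Conf) : ℝ :=
  (!![0, 1; -1, 0] : Matrix (Fin 2) (Fin 2) ℝ) a b *
    ![N q * pd 1 (fun q' => Real.log (M q')) q, -(M q * pd 0 (fun q' => Real.log (N q')) q)] c

/-- The matrix `u^a_b = f_{cb}^a λ^c`. -/
def uMat (M N : Conf → ℝ) (q : Conf) (l : Mult) : Matrix (Fin 2) (Fin 2) ℝ :=
  Matrix.of fun a b => ∑ c, structFn M N c b a q * l c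

/-- The entire matrix function `(e^{u/2} - e^{-u/2}) / u = ∑_k u^{2k} / (4^k (2k+1)!)`
(the matrix `u` need not be invertible). -/
def sinhDiv (u : Matrix (Fin 2) (Fin 2) ℝ) : Matrix (Fin 2) (Fin 2) ℝ :=
  ∑' k : ℕ, ((4 : ℝ) ^ k * (Nat.factorial (2 * k + 1) : ℝ))⁻¹ • u ^ (2 * k)

/-- `|j₀(u)| = det [(e^{u/2} - e^{-u/2}) / u]`. -/
def j0 (u : Matrix (Fin 2) (Fin 2) ℝ) : ℝ := (sinhDiv u).det

/-- The vector field `λ^a X_a = λ¹ M ∂_θ + λ² N ∂_φ` on the configuration space. -/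
def gaugeField (M N : Conf → ℝ) (l : Mult) (q : Conf) : Conf := ![l 0 * M q, l 1 * N q, 0]

/-- A vector field is complete: through each point there is an integral curve
that is defined for all times. -/
def CompleteField (X : Conf → Conf) : Prop :=
  ∀ q : Conf, ∃ γ : ℝ → Conf, γ 0 = q ∧ ∀ t, HasDerivAt γ (X (γ t)) t

/-! ### The Grassmann algebra in the four fermionic momenta

An element is given by its coefficients: `Ψ S` is the coefficient of the product, in increasing
order, of the generators with index in `S`. The generators `0, 1, 2, 3` are `ρ̄₁, ρ̄₂, ρ¹, ρ²`. -/

/-- The complex Grassmann algebra on four generators. -/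
abbrev Gr := Finset (Fin 4) → ℂ

/-- The sign that reorders (product over `S`) times (product over `T`), `S` and `T` disjoint. -/
def grSign (S T : Finset (Fin 4)) : ℂ := (-1) ^ ((S ×ˢ T).filter fun p => p.2 < p.1).card

/-- The product of the Grassmann algebra. -/
def grMul (Ψ Υ : Gr) : Gr := fun S =>
  ∑ T ∈ S.powerset, grSign T (S \ T) * Ψ T * Υ (S \ T)

/-- The generators. -/
def grGen (i : Fin 4) : Gr := Pi.single {i} 1

/-- The left derivative with respect to the `i`-th generator. -/
def grLeftDeriv (i : Fin 4) (Ψ : Gr) : Gr := fun S =>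
  if i ∈ S then 0 else (-1) ^ (S.filter fun j => j < i).card * Ψ (insert i S)

/-- The conjugation `*`: antilinear, order reversing, and with imaginary generators `ρ* = -ρ`. -/
def grStar (Ψ : Gr) : Gr := fun S =>
  (-1) ^ (S.card * (S.card + 1) / 2) * (starRingEnd ℂ) (Ψ S)

/-- The Berezin integral `∫ d²ρ̄ d²ρ`, normalised by `∫ d²ρ̄ d²ρ ρ̄₁ ρ̄₂ ρ¹ ρ² = 1`. -/
def berezin (Ψ : Gr) : ℂ := Ψ Finset.univ

/-! ### Wave functions and operators -/

/-- BRST wave functions `Ψ(q, λ, ρ̄, ρ)`. -/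
abbrev Wave := Conf × Mult → Gr

/-- The constraint operators `φ̂₁ = -i (M ∂_θ + (∂_θ M) / 2)` and `φ̂₂ = -i (N ∂_φ + (∂_φ N) / 2)`. -/
def phiOp (M N : Conf → ℝ) (a : Fin 2) (χ : Conf → ℂ) : Conf → ℂ := fun q =>
  -Complex.I * ((scale M N a q : ℂ) * pd a.castSucc χ q
    + (1 / 2 : ℂ) * ((pd a.castSucc (scale M N a) q : ℝ) : ℂ) * χ q)

/-- `i λ^a φ̂_a`, acting on functions on the configuration space. -/
def iLamPhi (M N : Conf → ℝ) (l : Mult) (χ : Conf → ℂ) : Conf → ℂ := fun q =>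
  Complex.I * ∑ a, (l a : ℂ) * phiOp M N a χ q

/-- `i λ^a φ̂_a`, acting on functions of `(q, λ)`; `λ` is a spectator. -/
def iLamPhiJoint (M N : Conf → ℝ) (Φ : Conf × Mult → ℂ) : Conf × Mult → ℂ := fun z =>
  iLamPhi M N z.2 (fun q => Φ (q, z.2)) z.1

/-- The constraint operators on BRST wave functions: `λ` and the fermions are spectators. -/
def wPhi (M N : Conf → ℝ) (a : Fin 2) (Ψ : Wave) : Wave := fun z S =>
  phiOp M N a (fun q => Ψ (q, z.2) S) z.1

/-- `π̂_a = -i ∂/∂λ^a`. -/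
def wPi (a : Fin 2) (Ψ : Wave) : Wave := fun z S =>
  -Complex.I * pd a (fun l => Ψ (z.1, l) S) z.2

/-- Multiplication by `ρ̄_a`. -/
def wRhoBar (a : Fin 2) (Ψ : Wave) : Wave := fun z => grMul (grGen (Fin.castAdd 2 a)) (Ψ z)

/-- Multiplication by `ρ^a`. -/
def wRho (a : Fin 2) (Ψ : Wave) : Wave := fun z => grMul (grGen (Fin.natAdd 2 a)) (Ψ z)

/-- `Ĉ^a = -i ∂^ℓ/∂ρ̄_a`. -/
def wC (a : Fin 2) (Ψ : Wave) : Wave := fun z =>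
  -Complex.I • grLeftDeriv (Fin.castAdd 2 a) (Ψ z)

/-- The BRST operator
`Ω̂ = (φ̂_a - (i/2) f_{ab}^b) Ĉ^a + (1/2) f_{ab}^c ρ̄_c Ĉ^a Ĉ^b - i ρ^a π̂_a`. -/
def Omega (M N : Conf → ℝ) (Ψ : Wave) : Wave := fun z =>
  (∑ a, (wPhi M N a (wC a Ψ) z
      - (Complex.I / 2 * ∑ b, (structFn M N a b b z.1 : ℂ)) • wC a Ψ z))
    + (1 / 2 : ℂ) • (∑ a, ∑ b, ∑ c,
        (structFn M N a b c z.1 : ℂ) • wRhoBar c (wC a (wC b Ψ)) z)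
    - Complex.I • ∑ a, wRho a (wPi a Ψ) z

/-- The gauge fixing fermion `ϱ̂`, determined by `i ϱ̂ = - λ^a ρ̄_a`. -/
def gaugeFermion (Ψ : Wave) : Wave := fun z =>
  Complex.I • ∑ a, (z.2 a : ℂ) • wRhoBar a Ψ z

/-- `i [Ω̂, ϱ̂]`, with the graded commutator of two odd operators, `Ω̂ ϱ̂ + ϱ̂ Ω̂`. -/
def iOmegaRho (M N : Conf → ℝ) (Ψ : Wave) : Wave := fun z =>
  Complex.I • (Omega M N (gaugeFermion Ψ) z + gaugeFermion (Omega M N Ψ) z)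

/-! ### Exponentials of differential operators -/

section Exponential

variable {E F : Type*} [NormedAddCommGroup E] [NormedSpace ℝ E] [NormedAddCommGroup F]
  [NormedSpace ℝ F]

/-- `Γ t = exp(t A) g` for all `t ∈ ℝ`: `Γ` is the classical (`C¹`) solution of
`dΓ/dt = A Γ` with `Γ 0 = g`. -/
def IsExpOrbit (A : (E → F) → E → F) (g : E → F) (Γ : ℝ → E → F) : Prop :=
  ContDiff ℝ 1 (fun p : ℝ × E => Γ p.1 p.2) ∧ Γ 0 = g ∧
    ∀ t z, HasDerivAt (fun s => Γ s z) (A (Γ t) z) t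

/-- The exponentials `exp(t A) g` are well defined. -/
def HasExp (A : (E → F) → E → F) (g : E → F) : Prop := ∃! Γ : ℝ → E → F, IsExpOrbit A g Γ

open Classical in
/-- `exp(A) g` (with the value `0` if it is not well defined). -/
def opExp (A : (E → F) → E → F) (g : E → F) : E → F :=
  if h : HasExp A g then h.exists.choose 1 else 0

end Exponential

/-! ### The sesquilinear forms -/

/-- The ghost-free, `λ`-independent wave function `Ψ = ψ(q)`. -/
def ghostFree (ψ : Conf → ℂ) : Wave := fun z => Pi.single ∅ (ψ z.1)

/-- The Grassmann integral `∫ d²ρ̄ d²ρ Ψ* Υ` at the point `(q, λ)`. -/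
def brstDensity (Ψ Υ : Wave) (z : Conf × Mult) : ℂ := berezin (grMul (grStar (Ψ z)) (Υ z))

/-- The form `⟨Ψ|Υ⟩ = c ∫ d²λ d³q d²ρ̄ d²ρ Ψ* Υ`. -/
def brstForm (c : ℂ) (Ψ Υ : Wave) : ℂ := c * ∫ z : Conf × Mult, brstDensity Ψ Υ z

/-- `V̂ χ = exp(i [Ω̂, ϱ̂]) χ` for a ghost-free, `λ`-independent `χ`. -/
def regState (M N : Conf → ℝ) (χ : Conf → ℂ) : Wave := opExp (iOmegaRho M N) (ghostFree χ)

/-- The regularised form `⟨ψ|exp(i [Ω̂, ϱ̂]) χ⟩`, with the constant `c = -1`. -/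
def regForm (M N : Conf → ℝ) (ψ χ : Conf → ℂ) : ℂ :=
  brstForm (-1) (ghostFree ψ) (regState M N χ)

/-- `|j₀(u(q, λ))| ψ*(q) [exp(i λ^a φ̂_a) χ](q)`. -/
def avgDensity (M N : Conf → ℝ) (ψ χ : Conf → ℂ) (z : Conf × Mult) : ℂ :=
  (j0 (uMat M N z.1 z.2) : ℂ) * (starRingEnd ℂ) (ψ z.1) * opExp (iLamPhi M N z.2) χ z.1

/-! ### The symmetric measure of a group -/

/-- `μ` is the symmetric measure `Δ^{1/2} d_L g` of `G`, for a left Haar measure `d_L g`. Here `Δ`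
is the modular function, `∫ F(g h) d_L g = Δ(h) ∫ F(g) d_L g`; thus `Δ d_L g` is right invariant. -/
def IsSymmetricHaar {G : Type*} [Group G] [TopologicalSpace G] [MeasurableSpace G]
    (μ : Measure G) : Prop :=
  ∃ (ν : Measure G) (Δ : G → ℝ), ν.IsHaarMeasure ∧
    (∀ h, 0 < Δ h ∧ ν.map (fun g => g * h) = ENNReal.ofReal (Δ h) • ν) ∧
    μ = ν.withDensity fun g => ENNReal.ofReal (Real.sqrt (Δ g))

/-- The exponential of a matrix, as an element of `GL(2, ℝ)`. -/
def expGL (A : Matrix (Fin 2) (Fin 2) ℝ) : (Matrix (Fin 2) (Fin 2) ℝ)ˣ :=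
  (Matrix.isUnit_exp A).unit

/-- The gauge group at the point `q`, in the adjoint representation: the subgroup of `GL(2, ℝ)` that
the exponentials of `λ^a ad(T_a) = u(q, λ)` generate, where `[T_a, T_b] = f_{ab}^c(q) T_c`. -/
def adjointGroup (M N : Conf → ℝ) (q : Conf) : Subgroup (Matrix (Fin 2) (Fin 2) ℝ)ˣ :=
  Subgroup.closure (Set.range fun l : Mult => expGL (uMat M N q l))

/-- The Borel structure of the gauge group. -/
instance (M N : Conf → ℝ) (q : Conf) : MeasurableSpace (adjointGroup M N q) := borel _

/-- The exponential coordinates `λ ↦ exp(λ^a ad(T_a))` of the gauge group. -/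
def adjointExp (M N : Conf → ℝ) (q : Conf) (l : Mult) : adjointGroup M N q :=
  ⟨expGL (uMat M N q l), Subgroup.subset_closure ⟨l, rfl⟩⟩

end BRST

end

/-! With two constraints the structure functions are `ε_{ab} α^c`, so `u = α ⊗ (-λ², λ¹)` has rank
at most one. Hence `u² = s u` with `s = tr u`, and `det u = 0`. Every power series in `u` collapses
to a constant plus a multiple of `u`, and all matrix functions reduce to `expQuot s = (e^s - 1) /
s`. In particular `j0 u = e^{-s/2} expQuot s` (`j0_of_mul_self`).

The anticommutators `[Ĉ^a, ρ̄_b]` and the Leibniz rule in `λ` turn `i[Ω̂, ϱ̂]` into the sum of `iλ^a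
φ̂_a`, a real transport operator along the gauge field, and the pointwise fermionic operator `s/2 -
u^c_b ρ̄_c ∂/∂ρ̄_b - ρ̄_a ρ^a` (`iOmegaRho_eq`). The Gaussian `ghost` solves the fermionic equation.
If the structure functions depend on `x` only, the gauge field annihilates `ghost`, since it moves
neither `x` nor `λ`; so the product of `ghost` with a solution of the bosonic equation solves the
full equation. The top coefficient of `ghost` at time one is `-j0 u`, which is the pointwise
formula, with no completeness needed.

For complete gauge fields the bosonic equation is solved along the flow, and uniqueness follows by
the method of characteristics. This needs a global flow that is jointly `C¹` in time and initial
point. Its regularity is proved through a linear equation for the difference of two trajectories,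
solved by the resolvent series.

For the group, `(1 + u(v)) (1 + u(w)) = 1 + u(v + (1 + σ v) w)` with `σ v = tr u(v)`. When `α ≠ 0`,
`v` is a coordinate that identifies the gauge group with the half plane `1 + σ v > 0`. There `dv /
(1 + σ v)²` is a left Haar measure and `1 + σ v` is the modular function. The exponential map is `λ
↦ expQuot(σ λ) λ`, and its Jacobian gives the density `j0`. -/

/-! ### Global flows of `C¹` vector fields -/

section Flow

open Set Metric Topology

variable {E : Type*} [NormedAddCommGroup E] [NormedSpace ℝ E]

/-- A `C¹` map is Lipschitz on every ball of a finite-dimensional space. -/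
theorem ContDiff.exists_lipschitzOnWith_closedBall [ProperSpace E] {f : E → E}
    (hf : ContDiff ℝ 1 f) (r : ℝ) : ∃ K : NNReal, LipschitzOnWith K f (closedBall 0 r) := by
  obtain ⟨C, hC⟩ := (isCompact_closedBall (0 : E) r).exists_bound_of_continuousOn
    (hf.continuous_fderiv one_ne_zero).continuousOn
  refine ⟨C.toNNReal, (convex_closedBall 0 r).lipschitzOnWith_of_nnnorm_fderiv_le
    (fun x _ => hf.differentiable one_ne_zero x) fun x hx => ?_⟩
  rw [← NNReal.coe_le_coe, coe_nnnorm]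
  exact (hC x hx).trans (Real.le_coe_toNNReal C)

/-- Integral curves of a `C¹` vector field are determined by their value at one time. -/
theorem integralCurve_unique [ProperSpace E] {f : E → E} (hf : ContDiff ℝ 1 f)
    {γ γ' : ℝ → E} (hγ : ∀ t, HasDerivAt γ (f (γ t)) t) (hγ' : ∀ t, HasDerivAt γ' (f (γ' t)) t)
    {t₀ : ℝ} (h : γ t₀ = γ' t₀) : γ = γ' := by
  have hc : Continuous γ := continuous_iff_continuousAt.2 fun t => (hγ t).continuousAt
  have hc' : Continuous γ' := continuous_iff_continuousAt.2 fun t => (hγ' t).continuousAt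
  ext t
  set T := max |t| |t₀| + 1 with hT
  obtain ⟨C, hC⟩ := (isCompact_Icc (a := -T) (b := T)).exists_bound_of_continuousOn hc.continuousOn
  obtain ⟨C', hC'⟩ :=
    (isCompact_Icc (a := -T) (b := T)).exists_bound_of_continuousOn hc'.continuousOn
  obtain ⟨K, hK⟩ := hf.exists_lipschitzOnWith_closedBall (max C C')
  have hmem : ∀ r : ℝ, |r| ≤ max |t| |t₀| → r ∈ Ioo (-T) T := fun r hr => by
    rw [mem_Ioo, ← abs_lt]; linarith
  refine ODE_solution_unique_of_mem_Ioo (v := fun _ => f) (s := fun _ => closedBall 0 (max C C'))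
    (fun _ _ => hK) (hmem t₀ (le_max_right _ _)) (fun s hs => ⟨hγ s, ?_⟩)
    (fun s hs => ⟨hγ' s, ?_⟩) h (hmem t (le_max_left _ _))
  · simpa using Or.inl (hC s (Ioo_subset_Icc_self hs))
  · simpa using Or.inr (hC' s (Ioo_subset_Icc_self hs))

/-- `φ` is the global flow of the vector field `f`. -/
structure IsGlobalFlow (f : E → E) (φ : ℝ → E → E) : Prop where
  zero : ∀ z, φ 0 z = z
  hasDerivAt : ∀ z t, HasDerivAt (fun s => φ s z) (f (φ t z)) t

namespace IsGlobalFlow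

variable {f : E → E} {φ : ℝ → E → E}

theorem continuous_time (h : IsGlobalFlow f φ) (z : E) : Continuous fun t => φ t z :=
  continuous_iff_continuousAt.2 fun t => (h.hasDerivAt z t).continuousAt

theorem add [ProperSpace E] (h : IsGlobalFlow f φ) (hf : ContDiff ℝ 1 f) (s t : ℝ) (z : E) :
    φ s (φ t z) = φ (s + t) z := by
  refine congr_fun (integralCurve_unique hf (γ := fun s => φ s (φ t z))
    (γ' := fun s => φ (s + t) z) (h.hasDerivAt _) (fun s => ?_) (t₀ := 0) ?_) s
  · exact (h.hasDerivAt z (s + t)).comp_add_const s t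
  · simp [h.zero]

/-- Trajectories that start close to each other stay close to each other up to time one. -/
theorem exists_dist_le [ProperSpace E] (h : IsGlobalFlow f φ) (hf : ContDiff ℝ 1 f) (z : E) :
    ∃ L > 0, ∀ δ > 0, L * δ ≤ 1 → ∀ z', ‖z' - z‖ ≤ δ →
      ∀ t ∈ Icc (0 : ℝ) 1, ‖φ t z' - φ t z‖ ≤ L * δ := by
  obtain ⟨C, hC⟩ := (isCompact_Icc (a := (0 : ℝ)) (b := 1)).exists_bound_of_continuousOn
    (h.continuous_time z).continuousOn
  obtain ⟨K, hK⟩ := hf.exists_lipschitzOnWith_closedBall (C + 1)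
  -- The barrier `δ e^{(K+1)t}` grows strictly faster than the Lipschitz constant `K` permits. The
  -- Lipschitz bound is used only where the distance meets the barrier; there the distance is at
  -- most `1`, so both points lie in the ball of radius `C + 1`.
  refine ⟨Real.exp (K + 1), Real.exp_pos _, fun δ hδ hL z' hz' => ?_⟩
  have hB : ∀ t : ℝ, HasDerivAt (fun t => δ * Real.exp ((K + 1) * t))
      (δ * (Real.exp ((K + 1) * t) * (K + 1))) t := fun t => by
    simpa using (((hasDerivAt_id t).const_mul ((K : ℝ) + 1)).exp).const_mul δ
  have hmono : ∀ t ∈ Icc (0 : ℝ) 1,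
      δ * Real.exp ((K + 1) * t) ≤ Real.exp (K + 1) * δ := fun t ht => by
    rw [mul_comm]
    gcongr
    nlinarith [ht.2, K.coe_nonneg]
  have key := image_norm_le_of_norm_deriv_right_lt_deriv_boundary (a := 0) (b := 1)
    (f := fun t => φ t z' - φ t z) (f' := fun t => f (φ t z') - f (φ t z))
    ((h.continuous_time z').sub (h.continuous_time z)).continuousOn
    (fun t _ => ((h.hasDerivAt z' t).sub (h.hasDerivAt z t)).hasDerivWithinAt)
    (by simpa [h.zero] using hz') hB fun t ht heq => ?_
  · exact fun t ht => (key ht).trans (hmono t ht)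
  · have ht' : t ∈ Icc (0 : ℝ) 1 := Ico_subset_Icc_self ht
    have h1 : ‖φ t z' - φ t z‖ ≤ 1 := heq.le.trans ((hmono t ht').trans hL)
    have h2 := hC t ht'
    have hpos : 0 < δ * Real.exp ((K + 1) * t) := by positivity
    have h3 := hK.dist_le_mul (φ t z') (by
      rw [mem_closedBall_zero_iff]
      calc ‖φ t z'‖ = ‖φ t z + (φ t z' - φ t z)‖ := by congr 1; abel
        _ ≤ C + 1 := (norm_add_le _ _).trans (add_le_add h2 h1)) (φ t z) (by
      rw [mem_closedBall_zero_iff]; linarith)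
    rw [dist_eq_norm, dist_eq_norm, heq] at h3
    nlinarith

/-- Times in `[0, 1]` suffice: the rescaling in `contDiff` recovers all others from the time-one
map. -/
theorem continuousOn [ProperSpace E] (h : IsGlobalFlow f φ) (hf : ContDiff ℝ 1 f) :
    ContinuousOn (fun p : ℝ × E => φ p.1 p.2) (Icc 0 1 ×ˢ univ) := by
  rintro ⟨t, z⟩ -
  obtain ⟨L, hL, H⟩ := h.exists_dist_le hf z
  rw [Metric.continuousWithinAt_iff]
  intro ε hε
  obtain ⟨η, hη, hη'⟩ := Metric.continuousAt_iff.1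
    ((h.continuous_time z).continuousAt (x := t)) (ε / 2) (half_pos hε)
  set δ := min 1 (ε / 2) / L with hδ
  have hδpos : 0 < δ := by positivity
  have hLδ : L * δ = min 1 (ε / 2) := by rw [hδ]; field_simp
  refine ⟨min η δ, lt_min hη hδpos, ?_⟩
  rintro ⟨t', z'⟩ ⟨ht', -⟩ hd
  rw [Prod.dist_eq, max_lt_iff] at hd
  have h1 := H δ hδpos (hLδ.le.trans (min_le_left _ _)) z'
    (by rw [← dist_eq_norm]; exact (hd.2.trans_le (min_le_right _ _)).le) t' ht'
  rw [← dist_eq_norm] at h1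
  have h2 := hη' (hd.1.trans_le (min_le_left _ _))
  have h3 : L * δ ≤ ε / 2 := hLδ.le.trans (min_le_right _ _)
  calc dist (φ t' z') (φ t z) ≤ dist (φ t' z') (φ t' z) + dist (φ t' z) (φ t z) :=
        dist_triangle _ _ _
    _ < ε := by linarith

end IsGlobalFlow

/-! ### The resolvent series of a linear equation, with parameters -/

/-- The iterated integrals of a family `a` of operators: the terms of the series for the resolvent
of the linear equation `w' = a w`. -/
noncomputable def dysonTerm {P : Type*} (a : P → ℝ → E →L[ℝ] E) : ℕ → P → ℝ → E →L[ℝ] E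
  | 0 => fun _ _ => 1
  | n + 1 => fun p t => ∫ τ in (0 : ℝ)..t, a p τ * dysonTerm a n p τ

/-- An integral of a function that is bounded by a monomial. -/
theorem norm_integral_le_pow_factorial {G : Type*} [NormedAddCommGroup G] [NormedSpace ℝ G]
    {g : ℝ → G} {C c t : ℝ} {n : ℕ} (ht : t ∈ Icc (0 : ℝ) 1)
    (h : ∀ τ ∈ Icc (0 : ℝ) 1, ‖g τ‖ ≤ C * (c * (C * τ) ^ n / n.factorial)) :
    ‖∫ τ in (0 : ℝ)..t, g τ‖ ≤ c * (C * t) ^ (n + 1) / (n + 1).factorial := by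
  have hi : ∫ τ in (0 : ℝ)..t, C * (c * (C * τ) ^ n / n.factorial)
      = c * (C * t) ^ (n + 1) / (n + 1).factorial := by
    have : ∀ τ : ℝ, C * (c * (C * τ) ^ n / n.factorial)
        = c * C ^ (n + 1) / n.factorial * τ ^ n := fun τ => by rw [mul_pow]; ring
    simp_rw [this]
    rw [intervalIntegral.integral_const_mul, integral_pow, Nat.factorial_succ]
    push_cast
    field_simp
    simp [mul_pow, mul_assoc]
  rw [← hi]
  refine intervalIntegral.norm_integral_le_of_norm_le ht.1 (Filter.Eventually.of_forall
    fun τ hτ => h τ ⟨hτ.1.le, hτ.2.trans ht.2⟩) ?_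
  exact Continuous.intervalIntegrable (by fun_prop) _ _

/-- The factor `1` keeps the bound in the shape `c * (C * t) ^ n / n!` that
`norm_integral_le_pow_factorial` reproduces. -/
theorem norm_dysonTerm_le {P : Type*} {a : P → ℝ → E →L[ℝ] E} {C : ℝ} {p : P}
    (hC : ∀ t ∈ Icc (0 : ℝ) 1, ‖a p t‖ ≤ C) (n : ℕ) {t : ℝ} (ht : t ∈ Icc (0 : ℝ) 1) :
    ‖dysonTerm a n p t‖ ≤ 1 * (C * t) ^ n / n.factorial := by
  have hC0 : 0 ≤ C := (norm_nonneg _).trans (hC t ht)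
  induction n generalizing t with
  | zero =>
    have : ‖(1 : E →L[ℝ] E)‖ ≤ 1 := ContinuousLinearMap.norm_id_le
    simpa [dysonTerm] using this
  | succ n ih =>
    refine norm_integral_le_pow_factorial ht fun τ hτ => (norm_mul_le _ _).trans ?_
    exact mul_le_mul (hC τ hτ) (ih hτ) (norm_nonneg _) hC0

section Dyson

variable {P : Type*} [TopologicalSpace P] {a : P → ℝ → E →L[ℝ] E}

theorem continuous_dysonTerm (ha : Continuous (Function.uncurry a)) (n : ℕ) :
    Continuous (Function.uncurry (dysonTerm a n)) := by
  induction n with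
  | zero => exact continuous_const
  | succ n ih =>
    exact intervalIntegral.continuous_parametric_primitive_of_continuous
      (f := fun p τ => a p τ * dysonTerm a n p τ) (ha.mul ih)

/-- On a compact neighbourhood of a parameter the series has the majorant `C ^ n / n!`, so it
converges locally uniformly. -/
theorem continuous_tsum_dysonTerm [LocallyCompactSpace P] [CompleteSpace E]
    (ha : Continuous (Function.uncurry a)) :
    Continuous fun p => ∑' n, dysonTerm a n p 1 := by
  refine continuous_iff_continuousAt.2 fun p => ?_
  obtain ⟨K, hK, hp⟩ := exists_compact_mem_nhds p
  obtain ⟨C, hC⟩ := (hK.prod (isCompact_Icc (a := (0 : ℝ)) (b := 1))).exists_bound_of_continuousOn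
    ha.continuousOn
  have h1 : ∀ n, Continuous fun p => dysonTerm a n p 1 := fun n =>
    (continuous_dysonTerm ha n).comp (by fun_prop : Continuous fun p : P => (p, (1 : ℝ)))
  have h2 : ∀ n q, q ∈ K → ‖dysonTerm a n q 1‖ ≤ C ^ n / n.factorial := fun n q hq => by
    simpa using norm_dysonTerm_le (fun t ht => hC (q, t) ⟨hq, ht⟩) n (t := 1) (by simp)
  exact (continuousOn_tsum (fun n => (h1 n).continuousOn)
    (Real.summable_pow_div_factorial C) h2).continuousAt hp

/-- A solution of the linear equation `w' = a w` is given by the resolvent series. -/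
theorem eq_tsum_dysonTerm_apply [CompleteSpace E] (ha : Continuous (Function.uncurry a)) (p : P)
    {w : ℝ → E} (hwc : Continuous w)
    (hw : ∀ t ∈ Icc (0 : ℝ) 1, w t = w 0 + ∫ τ in (0 : ℝ)..t, a p τ (w τ)) :
    w 1 = (∑' n, dysonTerm a n p 1) (w 0) := by
  have hap : Continuous (a p) := ha.comp (by fun_prop : Continuous fun τ : ℝ => (p, τ))
  have hdp : ∀ n, Continuous (dysonTerm a n p) := fun n =>
    (continuous_dysonTerm ha n).comp (by fun_prop : Continuous fun τ : ℝ => (p, τ))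
  obtain ⟨C, hC⟩ := (isCompact_Icc (a := (0 : ℝ)) (b := 1)).exists_bound_of_continuousOn
    hap.continuousOn
  obtain ⟨c, hc⟩ := (isCompact_Icc (a := (0 : ℝ)) (b := 1)).exists_bound_of_continuousOn
    hwc.continuousOn
  have hC0 : 0 ≤ C := (norm_nonneg _).trans (hC 0 (by simp))
  -- Picard iteration: each remainder is the integral of `a` applied to the preceding one, so it
  -- gains a factor `C t / (n + 1)`.
  have hrem : ∀ n, ∀ t ∈ Icc (0 : ℝ) 1,
      ‖w t - ∑ k ∈ Finset.range n, dysonTerm a k p t (w 0)‖ ≤ c * (C * t) ^ n / n.factorial := by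
    intro n
    induction n with
    | zero => intro t ht; simpa using hc t ht
    | succ n ih =>
      intro t ht
      have : w t - ∑ k ∈ Finset.range (n + 1), dysonTerm a k p t (w 0)
          = ∫ τ in (0 : ℝ)..t, a p τ (w τ - ∑ k ∈ Finset.range n, dysonTerm a k p τ (w 0)) := by
        simp only [map_sub, map_sum]
        rw [intervalIntegral.integral_sub, intervalIntegral.integral_finsetSum, hw t ht,
          Finset.sum_range_succ']
        · have : ∀ k, dysonTerm a (k + 1) p t (w 0)
              = ∫ τ in (0 : ℝ)..t, a p τ (dysonTerm a k p τ (w 0)) := fun k => by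
            rw [dysonTerm, ContinuousLinearMap.intervalIntegral_apply]
            · rfl
            · exact (hap.mul (hdp k)).intervalIntegrable _ _
          simp only [this]
          simp only [dysonTerm, one_apply_eq_self]
          abel
        · intro k _
          exact Continuous.intervalIntegrable (by have := hdp k; fun_prop) _ _
        · exact Continuous.intervalIntegrable (by fun_prop) _ _
        · exact Continuous.intervalIntegrable (by have := hdp; fun_prop) _ _
      rw [this]
      refine norm_integral_le_pow_factorial ht fun τ hτ => ?_
      exact (ContinuousLinearMap.le_opNorm _ _).trans
        (mul_le_mul (hC τ hτ) (ih τ hτ) (norm_nonneg _) hC0)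
  have hsum : Summable fun n => dysonTerm a n p 1 :=
    Summable.of_norm_bounded (Real.summable_pow_div_factorial C) fun n => by
      simpa using norm_dysonTerm_le hC n (t := 1) (by simp)
  have h1 : HasSum (fun n => dysonTerm a n p 1 (w 0)) ((∑' n, dysonTerm a n p 1) (w 0)) :=
    (ContinuousLinearMap.apply ℝ E (w 0)).hasSum hsum.hasSum
  have h2 := h1.tendsto_sum_nat
  refine tendsto_nhds_unique ?_ h2
  have h3 : Filter.Tendsto (fun n : ℕ => c * (C ^ n / n.factorial)) Filter.atTop (𝓝 (c * 0)) :=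
    (FloorSemiring.tendsto_pow_div_factorial_atTop C).const_mul c
  rw [mul_zero] at h3
  have h4 := squeeze_zero_norm (fun n => by simpa [mul_div_assoc] using hrem n 1 (by simp)) h3
  simpa using h4.const_sub (w 1)

end Dyson

/-! ### Differentiability of the flow -/

namespace IsGlobalFlow

variable {f : E → E} {φ : ℝ → E → E}

/-- The time-one map of the global flow of a `C¹` vector field is `C¹`. -/
theorem contDiff_one [FiniteDimensional ℝ E] (h : IsGlobalFlow f φ) (hf : ContDiff ℝ 1 f) :
    ContDiff ℝ 1 (φ 1) := by
  have : ProperSpace E := FiniteDimensional.proper_real E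
  have : CompleteSpace E := FiniteDimensional.complete ℝ E
  have hDf : Continuous (fderiv ℝ f) := hf.continuous_fderiv one_ne_zero
  -- Hadamard's lemma: the mean of the derivative over a segment turns a difference of values of `f`
  -- into an exact linear expression with a continuous coefficient.
  let g : E × E → E →L[ℝ] E := fun y => ∫ s in (0 : ℝ)..1, fderiv ℝ f (y.1 + s • (y.2 - y.1))
  have hg : Continuous g := intervalIntegral.continuous_parametric_intervalIntegral_of_continuous'
    (f := fun (y : E × E) (s : ℝ) => fderiv ℝ f (y.1 + s • (y.2 - y.1)))
    (hDf.comp (by fun_prop)) 0 1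
  have hadamard : ∀ y y' : E, f y' - f y = g (y, y') (y' - y) := fun y y' => by
    have hi : IntervalIntegrable (fun s : ℝ => fderiv ℝ f (y + s • (y' - y))) volume 0 1 :=
      (hDf.comp (by fun_prop)).intervalIntegrable _ _
    rw [ContinuousLinearMap.intervalIntegral_apply hi, intervalIntegral.integral_eq_sub_of_hasDerivAt
      (f := fun s : ℝ => f (y + s • (y' - y)))]
    · simp
    · intro s _
      have h1 : HasDerivAt (fun s : ℝ => y + s • (y' - y)) (y' - y) s := by
        simpa using ((hasDerivAt_id s).smul_const (y' - y)).const_add y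
      exact (hf.differentiable one_ne_zero _).hasFDerivAt.comp_hasDerivAt s h1
    · exact ((hDf.comp (by fun_prop)).clm_apply continuous_const).intervalIntegrable _ _
  -- Time is clamped to `[0, 1]`, where the flow is known to be continuous, so that the coefficient
  -- `a` is continuous for all times.
  let c : ℝ → ℝ := fun t => max 0 (min t 1)
  have hc : ∀ t, c t ∈ Icc (0 : ℝ) 1 := fun t => ⟨le_max_left _ _, by simp [c]⟩
  have hc' : ∀ t ∈ Icc (0 : ℝ) 1, c t = t := fun t ht => by simp [c, ht.1, ht.2]
  have hcc : Continuous c := by fun_prop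
  have hφc : Continuous fun p : ℝ × E => φ (c p.1) p.2 :=
    (h.continuousOn hf).comp_continuous (f := fun p : ℝ × E => (c p.1, p.2)) (by fun_prop)
      fun p => ⟨hc p.1, trivial⟩
  let a : E × E → ℝ → E →L[ℝ] E := fun p t => g (φ (c t) p.1, φ (c t) p.2)
  have ha : Continuous (Function.uncurry a) := by
    refine hg.comp ?_
    exact (hφc.comp (by fun_prop : Continuous fun q : (E × E) × ℝ => (q.2, q.1.1))).prodMk
      (hφc.comp (by fun_prop : Continuous fun q : (E × E) × ℝ => (q.2, q.1.2)))
  let R : E × E → E →L[ℝ] E := fun p => ∑' n, dysonTerm a n p 1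
  have hR : Continuous R := continuous_tsum_dysonTerm ha
  -- The difference of two trajectories solves the linear equation with coefficient `a` exactly. As
  -- `R` is continuous, the derivative at `z` can be read off as `R (z, z)`.
  have key : ∀ z z', φ 1 z' - φ 1 z = R (z, z') (z' - z) := fun z z' => by
    have hfc := hf.continuous
    have := eq_tsum_dysonTerm_apply ha (z, z') (w := fun t => φ t z' - φ t z)
      ((h.continuous_time z').sub (h.continuous_time z)) fun t ht => ?_
    · simpa [h.zero] using this
    · have h1 : ∀ τ ∈ uIcc 0 t, HasDerivAt (fun t => φ t z' - φ t z)
          (a (z, z') τ (φ τ z' - φ τ z)) τ := fun τ hτ => by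
        rw [uIcc_of_le ht.1] at hτ
        simp only [a]
        rw [hc' τ ⟨hτ.1, hτ.2.trans ht.2⟩, ← hadamard]
        exact (h.hasDerivAt z' τ).sub (h.hasDerivAt z τ)
      rw [intervalIntegral.integral_eq_sub_of_hasDerivAt h1]
      · simp
      · refine Continuous.intervalIntegrable (Continuous.clm_apply ?_
          ((h.continuous_time z').sub (h.continuous_time z))) _ _
        exact ha.comp (by fun_prop : Continuous fun τ : ℝ => ((z, z'), τ))
  have hder : ∀ z, HasFDerivAt (φ 1) (R (z, z)) z := fun z => by
    rw [hasFDerivAt_iff_isLittleO]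
    have h1 : (fun z' => φ 1 z' - φ 1 z - R (z, z) (z' - z))
        = fun z' => (R (z, z') - R (z, z)) (z' - z) := by
      ext z'; rw [key]; simp
    rw [h1, Asymptotics.isLittleO_iff]
    intro ε hε
    have h2 : Continuous fun z' => R (z, z') := hR.comp (by fun_prop)
    filter_upwards [Metric.continuousAt_iff'.1 (h2.continuousAt (x := z)) ε hε] with z' hz'
    rw [dist_eq_norm] at hz'
    exact (ContinuousLinearMap.le_opNorm _ _).trans (by gcongr)
  rw [contDiff_one_iff_fderiv]
  refine ⟨fun z => (hder z).differentiableAt, ?_⟩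
  have : fderiv ℝ (φ 1) = fun z => R (z, z) := funext fun z => (hder z).fderiv
  rw [this]
  exact hR.comp (by fun_prop)

/-- The global flow of a `C¹` vector field is jointly `C¹` in time and the initial point. -/
theorem contDiff [FiniteDimensional ℝ E] (h : IsGlobalFlow f φ) (hf : ContDiff ℝ 1 f) :
    ContDiff ℝ 1 fun p : ℝ × E => φ p.1 p.2 := by
  -- Time becomes a constant coordinate that rescales the field; the time-one map of the enlarged
  -- flow is `(t, z) ↦ (t, φ t z)`.
  have h1 : IsGlobalFlow (fun p : ℝ × E => ((0 : ℝ), p.1 • f p.2))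
      (fun t p => (p.1, φ (t * p.1) p.2)) := by
    refine ⟨fun p => by simp [h.zero], fun p t => ?_⟩
    refine (hasDerivAt_const t p.1).prodMk ?_
    have h2 : HasDerivAt (fun t => t * p.1) p.1 t := by simpa using (hasDerivAt_id t).mul_const p.1
    exact (h.hasDerivAt p.2 (t * p.1)).scomp t h2
  have h2 := (h1.contDiff_one (by fun_prop)).snd
  simpa using h2

end IsGlobalFlow

end Flow

/-! ### The functions `(e^y - 1) / y` and `(e^y - 1 - y) / y²` -/

section ExpQuot

open Topology

/-- The difference quotients of an analytic function are analytic. -/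
theorem AnalyticOnNhd.dslope_univ {f : ℝ → ℝ} (hf : AnalyticOnNhd ℝ f Set.univ) (c : ℝ) :
    AnalyticOnNhd ℝ (dslope f c) Set.univ := by
  intro y _
  rcases eq_or_ne y c with rfl | hy
  · obtain ⟨p, hp⟩ := hf y trivial
    exact ⟨_, hp.has_fpower_series_dslope_fslope⟩
  · have h1 : AnalyticAt ℝ (fun x => (x - c)⁻¹ * (f x - f c)) y :=
      ((analyticAt_id.sub analyticAt_const).inv (sub_ne_zero.2 hy)).mul
        ((hf y trivial).sub analyticAt_const)
    refine h1.congr ?_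
    filter_upwards [isOpen_ne.mem_nhds hy] with x hx
    rw [dslope_of_ne _ hx, slope, vsub_eq_sub, smul_eq_mul]

/-- The entire function `(e^y - 1) / y`. -/
noncomputable def expQuot : ℝ → ℝ := dslope Real.exp 0

/-- The entire function `(e^y - 1 - y) / y²`. -/
noncomputable def expQuot₂ : ℝ → ℝ := dslope expQuot 0

theorem analyticOnNhd_expQuot : AnalyticOnNhd ℝ expQuot Set.univ :=
  AnalyticOnNhd.dslope_univ (fun _ _ => analyticAt_rexp) 0

theorem contDiff_expQuot {n : WithTop ℕ∞} : ContDiff ℝ n expQuot :=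
  contDiffOn_univ.1 analyticOnNhd_expQuot.contDiffOn_of_completeSpace

theorem contDiff_expQuot₂ {n : WithTop ℕ∞} : ContDiff ℝ n expQuot₂ :=
  contDiffOn_univ.1 (analyticOnNhd_expQuot.dslope_univ 0).contDiffOn_of_completeSpace

theorem expQuot_zero : expQuot 0 = 1 := by simp [expQuot, dslope_same]

theorem mul_expQuot (y : ℝ) : y * expQuot y = Real.exp y - 1 := by
  simpa [expQuot] using sub_smul_dslope Real.exp 0 y

theorem mul_expQuot₂ (y : ℝ) : y * expQuot₂ y = expQuot y - 1 := by
  simpa [expQuot_zero, expQuot₂] using sub_smul_dslope expQuot 0 y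

theorem expQuot_pos (y : ℝ) : 0 < expQuot y := by
  rcases lt_trichotomy y 0 with hy | rfl | hy
  · have := mul_expQuot y
    have h2 : Real.exp y < 1 := by simpa using hy
    by_contra h
    nlinarith
  · simp [expQuot_zero]
  · have := mul_expQuot y
    have h2 : 1 < Real.exp y := Real.one_lt_exp_iff.2 hy
    by_contra h
    nlinarith

theorem expQuot_neg (y : ℝ) : expQuot (-y) = Real.exp (-y) * expQuot y := by
  rcases eq_or_ne y 0 with rfl | hy
  · simp
  · refine mul_left_cancel₀ (neg_ne_zero.2 hy) ?_
    have h : Real.exp (-y) * Real.exp y = 1 := by rw [← Real.exp_add]; simp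
    rw [mul_expQuot]
    linear_combination Real.exp (-y) * mul_expQuot y + h

theorem hasDerivAt_expQuot (y : ℝ) : HasDerivAt expQuot (deriv expQuot y) y :=
  (contDiff_expQuot.differentiable one_ne_zero y).hasDerivAt

theorem hasDerivAt_expQuot₂ (y : ℝ) : HasDerivAt expQuot₂ (deriv expQuot₂ y) y :=
  (contDiff_expQuot₂.differentiable one_ne_zero y).hasDerivAt

theorem expQuot_add_mul_deriv (y : ℝ) : expQuot y + y * deriv expQuot y = Real.exp y := by
  have h1 := (hasDerivAt_id y).mul (hasDerivAt_expQuot y)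
  have h2 : (id * expQuot : ℝ → ℝ) = fun y => Real.exp y - 1 := funext mul_expQuot
  rw [h2] at h1
  simpa using h1.unique ((Real.hasDerivAt_exp y).sub_const 1)

/-- This is the derivative of `y² expQuot₂ y = e^y - 1 - y`, divided by `y`; the point `0` is
covered by continuity and density. -/
theorem expQuot₂_add_mul_deriv (y : ℝ) :
    2 * expQuot₂ y + y * deriv expQuot₂ y = expQuot y := by
  have h0 : ∀ y, expQuot₂ y + y * deriv expQuot₂ y = deriv expQuot y := fun y => by
    have h1 := (hasDerivAt_id y).mul (hasDerivAt_expQuot₂ y)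
    have h2 : (id * expQuot₂ : ℝ → ℝ) = fun y => expQuot y - 1 := funext mul_expQuot₂
    rw [h2] at h1
    simpa using h1.unique ((hasDerivAt_expQuot y).sub_const 1)
  have hc : Continuous (deriv expQuot₂) :=
    (contDiff_expQuot₂ (n := 1)).continuous_deriv le_rfl
  have hc₁ : Continuous expQuot := (contDiff_expQuot (n := 0)).continuous
  have hc₂ : Continuous expQuot₂ := (contDiff_expQuot₂ (n := 0)).continuous
  have hd : Dense ({0}ᶜ : Set ℝ) := dense_compl_singleton 0
  refine congr_fun (Continuous.ext_on hd (f := fun y => 2 * expQuot₂ y + y * deriv expQuot₂ y)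
    (by fun_prop) hc₁ fun y hy => ?_) y
  refine mul_left_cancel₀ (a := y) (by simpa using hy) ?_
  linear_combination mul_expQuot₂ y + y * h0 y + expQuot_add_mul_deriv y - mul_expQuot y

theorem hasSum_expQuot (y : ℝ) :
    HasSum (fun n : ℕ => ((n + 1).factorial : ℝ)⁻¹ * y ^ n) (expQuot y) := by
  rcases eq_or_ne y 0 with rfl | hy
  · rw [expQuot_zero]
    convert hasSum_single (f := fun n : ℕ => ((n + 1).factorial : ℝ)⁻¹ * (0 : ℝ) ^ n) 0 ?_ using 1
    · simp
    · intro n hn; simp [hn]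
  · have h1 : HasSum (fun n : ℕ => y ^ n / n.factorial) (Real.exp y) := by
      rw [Real.exp_eq_exp_ℝ]; exact NormedSpace.expSeries_div_hasSum_exp y
    have h2 := ((hasSum_nat_add_iff' 1).2 h1).mul_left y⁻¹
    have h3 : expQuot y = y⁻¹ * (Real.exp y - 1) := by rw [← mul_expQuot]; field_simp
    rw [h3]
    have h4 : ∀ n : ℕ, ((n + 1).factorial : ℝ)⁻¹ * y ^ n
        = y⁻¹ * (y ^ (n + 1) / (n + 1).factorial) := fun n => by rw [pow_succ]; field_simp
    simp_rw [h4]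
    simpa using h2

/-- The primitive `t ↦ (1 - e^{-ts}) / s` of `t ↦ e^{-ts}`. -/
noncomputable def expPrim (t s : ℝ) : ℝ := t * expQuot (-(t * s))

/-- The primitive of `t ↦ (1 - e^{-ts}) / s`. -/
noncomputable def expPrim₂ (t s : ℝ) : ℝ := t ^ 2 * expQuot₂ (-(t * s))

theorem mul_expPrim₂ (t s : ℝ) : s * expPrim₂ t s = t - expPrim t s := by
  have := mul_expQuot₂ (-(t * s))
  unfold expPrim₂ expPrim
  linear_combination (-t) * this

theorem mul_expPrim (t s : ℝ) : s * expPrim t s = 1 - Real.exp (-(t * s)) := by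
  have := mul_expQuot (-(t * s))
  unfold expPrim
  linear_combination -this

/-- The derivative `e^{-ts}` is left as `1 - s * expPrim t s`, so that the verification in
`hasDerivAt_ghost` is polynomial in `expPrim` and `expPrim₂`. -/
theorem hasDerivAt_expPrim (t s : ℝ) :
    HasDerivAt (fun t => expPrim t s) (1 - s * expPrim t s) t := by
  have h1 : HasDerivAt (fun t => -(t * s)) (-s) t := by
    simpa [Pi.neg_def] using ((hasDerivAt_id t).mul_const s).neg
  have h2 := (hasDerivAt_id t).mul ((hasDerivAt_expQuot (-(t * s))).comp t h1)
  refine h2.congr_deriv ?_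
  have := expQuot_add_mul_deriv (-(t * s))
  rw [mul_expPrim, ← Real.exp_zero]
  simp only [id, Function.comp_apply, Real.exp_zero]
  linear_combination this

theorem hasDerivAt_expPrim₂ (t s : ℝ) :
    HasDerivAt (fun t => expPrim₂ t s) (expPrim t s) t := by
  have h1 : HasDerivAt (fun t => -(t * s)) (-s) t := by
    simpa [Pi.neg_def] using ((hasDerivAt_id t).mul_const s).neg
  have h2 := (hasDerivAt_pow 2 t).mul ((hasDerivAt_expQuot₂ (-(t * s))).comp t h1)
  refine h2.congr_deriv ?_
  have := expQuot₂_add_mul_deriv (-(t * s))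
  simp only [expPrim, Function.comp_apply]
  push_cast
  linear_combination t * this

theorem contDiff_expPrim {n : WithTop ℕ∞} : ContDiff ℝ n fun p : ℝ × ℝ => expPrim p.1 p.2 :=
  contDiff_fst.mul (contDiff_expQuot.comp (contDiff_fst.mul contDiff_snd).neg)

theorem contDiff_expPrim₂ {n : WithTop ℕ∞} : ContDiff ℝ n fun p : ℝ × ℝ => expPrim₂ p.1 p.2 :=
  (contDiff_fst.pow 2).mul (contDiff_expQuot₂.comp (contDiff_fst.mul contDiff_snd).neg)

end ExpQuot

/-! ### Power series of a matrix `u` with `u² = s u` -/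

section MatrixSeries

variable {n : Type*} [Fintype n] [DecidableEq n]

theorem Matrix.pow_succ_of_mul_self {u : Matrix n n ℝ} {s : ℝ} (hu : u * u = s • u) (k : ℕ) :
    u ^ (k + 1) = s ^ k • u := by
  induction k with
  | zero => simp
  | succ k ih => rw [pow_succ, ih, smul_mul_assoc, hu, smul_smul, pow_succ]

/-- Since `u ^ (k + 1) = s ^ k • u`, only the constant term and a multiple of `u` survive. Nothing
is divided by `s`, so the nilpotent case `s = 0` is included. -/
theorem Matrix.hasSum_pow_of_mul_self {u : Matrix n n ℝ} {s : ℝ} (hu : u * u = s • u)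
    {a : ℕ → ℝ} {A : ℝ} (ha : HasSum (fun k => a (k + 1) * s ^ k) A) :
    HasSum (fun k => a k • u ^ k) (a 0 • 1 + A • u) := by
  rw [← hasSum_nat_add_iff' 1]
  have : HasSum (fun k => (a (k + 1) * s ^ k) • u) (A • u) := ha.smul_const u
  simpa [Matrix.pow_succ_of_mul_self hu, smul_smul] using this

theorem Matrix.exp_of_mul_self {u : Matrix n n ℝ} {s : ℝ} (hu : u * u = s • u) :
    NormedSpace.exp u = 1 + expQuot s • u := by
  rw [NormedSpace.exp_eq_tsum ℝ]
  simpa using (Matrix.hasSum_pow_of_mul_self hu (a := fun k => (k.factorial : ℝ)⁻¹)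
    (hasSum_expQuot s)).tsum_eq

end MatrixSeries

/-! ### The rank-one matrix `u` and its determinant factor -/

namespace BRST

/-- The series collapses to `1 + A u`. As `det u = 0`, its determinant is `1 + A s = sinh(s/2) /
(s/2)`, the eigenvalue that belongs to `s`. -/
theorem j0_of_mul_self {u : Matrix (Fin 2) (Fin 2) ℝ} {s : ℝ} (hu : u * u = s • u)
    (ht : u.trace = s) (hd : u.det = 0) : j0 u = Real.exp (-(s / 2)) * expQuot s := by
  set c : ℕ → ℝ := fun k => ((4 : ℝ) ^ k * (Nat.factorial (2 * k + 1) : ℝ))⁻¹ with hc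
  obtain ⟨A, hA, hA'⟩ : ∃ A, HasSum (fun k => c (k + 1) * s ^ (2 * k + 1)) A ∧
      1 + A * s = Real.exp (-(s / 2)) * expQuot s := by
    rcases eq_or_ne s 0 with rfl | hs
    · refine ⟨0, by simp [hasSum_zero], by simp [expQuot_zero]⟩
    -- This value of `A` solves `1 + A s = sinh(s/2) / (s/2)`; the sum for `A` is the `sinh` series
    -- without its first term.
    · refine ⟨s⁻¹ * ((s / 2)⁻¹ * Real.sinh (s / 2) - 1), ?_, ?_⟩
      · have h1 := ((hasSum_nat_add_iff' 1).2
          ((Real.hasSum_sinh (s / 2)).mul_left (s / 2)⁻¹)).mul_left s⁻¹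
        have h2 : ∀ k, c (k + 1) * s ^ (2 * k + 1)
            = s⁻¹ * ((s / 2)⁻¹ * ((s / 2) ^ (2 * (k + 1) + 1) / (2 * (k + 1) + 1).factorial)) := by
          intro k
          have h3 : (s / 2) ^ (2 * (k + 1) + 1) = s * s * s ^ (2 * k + 1) / (8 * 4 ^ k) := by
            rw [show 2 * (k + 1) + 1 = 2 * k + 3 by ring, div_pow, pow_add 2, pow_mul]
            norm_num
            ring
          rw [h3, hc]
          have : ((2 * (k + 1) + 1).factorial : ℝ) ≠ 0 := by positivity
          simp only [pow_succ (4 : ℝ)]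
          field_simp
          norm_num
        simp_rw [h2]
        simpa [hs] using h1
      · have h2 := mul_expQuot s
        have h3 : Real.exp s = Real.exp (s / 2) * Real.exp (s / 2) := by
          rw [← Real.exp_add]; congr 1; ring
        have h4 : Real.exp (-(s / 2)) * Real.exp (s / 2) = 1 := by rw [← Real.exp_add]; simp
        refine mul_left_cancel₀ hs ?_
        rw [Real.sinh_eq]
        field_simp
        linear_combination (-Real.exp (-(s / 2))) * h2 - Real.exp (-(s / 2)) * h3
          - Real.exp (s / 2) * h4
  have hu2 : u ^ 2 * u ^ 2 = (s ^ 2) • u ^ 2 := by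
    rw [sq u, hu, smul_mul_smul_comm, hu, smul_smul, smul_smul]; ring_nf
  have h1 : sinhDiv u = 1 + A • u := by
    have h2 : HasSum (fun k => c k • u ^ (2 * k)) (1 + A • u) := by
      rw [← hasSum_nat_add_iff' 1]
      have h3 : HasSum (fun k => (c (k + 1) * s ^ (2 * k + 1)) • u) (A • u) := hA.smul_const u
      have h4 : ∀ k, u ^ (2 * (k + 1)) = s ^ (2 * k + 1) • u := fun k =>
        Matrix.pow_succ_of_mul_self hu (2 * k + 1)
      simpa [h4, smul_smul, hc] using h3
    exact h2.tsum_eq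
  rw [j0, h1, ← hA', ← ht]
  rw [Matrix.det_fin_two] at hd
  simp only [Matrix.det_fin_two, Matrix.add_apply, Matrix.smul_apply, Matrix.trace_fin_two,
    Matrix.one_apply, smul_eq_mul]
  norm_num
  linear_combination A ^ 2 * hd

section Structure

variable (M N : Conf → ℝ)

/-- The coefficient of the matrix `u` along the gauge directions: `u^a_b = α^a w_b`. -/
noncomputable def coef (a : Fin 2) (q : Conf) : ℝ := structFn M N 0 1 a q

/-- The trace `s` of the matrix `u`. -/
noncomputable def trU (z : Conf × Mult) : ℝ := coef M N 1 z.1 * z.2 0 - coef M N 0 z.1 * z.2 1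

variable {M N}

theorem structFn_eq (a b c : Fin 2) (q : Conf) :
    structFn M N a b c q = (!![0, 1; -1, 0] : Matrix (Fin 2) (Fin 2) ℝ) a b * coef M N c q := by
  simp [coef, structFn]

/-- An antisymmetric bracket of two generators is fixed by the single vector `α^c = f_{12}^c`. The
rank-one form yields `u² = (tr u) u` and `det u = 0`. -/
theorem uMat_eq (q : Conf) (l : Mult) :
    uMat M N q l = Matrix.of fun a b => coef M N a q * ![-l 1, l 0] b := by
  ext a b
  fin_cases b <;> simp [uMat, structFn_eq, Fin.sum_univ_two, mul_comm]

theorem uMat_mul_self (q : Conf) (l : Mult) :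
    uMat M N q l * uMat M N q l = trU M N (q, l) • uMat M N q l := by
  ext a b
  simp [uMat_eq, Matrix.mul_apply, Fin.sum_univ_two, trU]
  ring

theorem trace_uMat (q : Conf) (l : Mult) : (uMat M N q l).trace = trU M N (q, l) := by
  simp [uMat_eq, Matrix.trace_fin_two, trU]
  ring

theorem det_uMat (q : Conf) (l : Mult) : (uMat M N q l).det = 0 := by
  simp [uMat_eq, Matrix.det_fin_two]
  ring

theorem j0_uMat (q : Conf) (l : Mult) : j0 (uMat M N q l)
    = Real.exp (-(trU M N (q, l) / 2)) * expQuot (trU M N (q, l)) :=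
  j0_of_mul_self (uMat_mul_self q l) (trace_uMat q l) (det_uMat q l)

theorem j0_uMat_pos (q : Conf) (l : Mult) : 0 < j0 (uMat M N q l) := by
  rw [j0_uMat]
  exact mul_pos (Real.exp_pos _) (expQuot_pos _)

theorem sum_structFn_zero (q : Conf) : ∑ b, structFn M N 0 b b q = coef M N 1 q := by
  simp [structFn_eq, Fin.sum_univ_two]

theorem sum_structFn_one (q : Conf) : ∑ b, structFn M N 1 b b q = -coef M N 0 q := by
  simp [structFn_eq, Fin.sum_univ_two]

theorem j0_uMat_of_unimodular {q : Conf} (h : ∀ a, ∑ b, structFn M N a b b q = 0) (l : Mult) :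
    j0 (uMat M N q l) = 1 := by
  have h0 := h 0
  have h1 := h 1
  rw [sum_structFn_zero] at h0
  rw [sum_structFn_one, neg_eq_zero] at h1
  simp [j0_uMat, trU, h0, h1, expQuot_zero]

theorem contDiff_coef (hM : ContDiff ℝ ∞ M) (hN : ContDiff ℝ ∞ N) (hMpos : ∀ q, 0 < M q)
    (hNpos : ∀ q, 0 < N q) (a : Fin 2) : ContDiff ℝ ∞ (coef M N a) := by
  have key : ∀ {P Q : Conf → ℝ} (i : Fin 3), ContDiff ℝ ∞ P → ContDiff ℝ ∞ Q → (∀ q, 0 < P q) →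
      ContDiff ℝ ∞ fun q => Q q * pd i (fun q' => Real.log (P q')) q := fun i hP hQ hpos =>
    hQ.mul (((hP.log fun q => (hpos q).ne').fderiv_right (by simp)).clm_apply contDiff_const)
  unfold coef structFn
  fin_cases a
  · simpa using key 1 hM hN hMpos
  · simpa using (key 0 hN hM hNpos).neg

end Structure

end BRST

namespace BRST

/-! ### Creation and annihilation operators of the Grassmann algebra -/

section Grassmann

/-- The sign `(-1)^k`, where `k` is the number of elements of `S` below `i`. -/
def genSign (i : Fin 4) (S : Finset (Fin 4)) : ℤ := (-1) ^ (S.filter fun j => j < i).card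

theorem grMul_grGen_apply (i : Fin 4) (Ψ : Gr) (S : Finset (Fin 4)) :
    grMul (grGen i) Ψ S = if i ∈ S then (genSign i S : ℂ) * Ψ (S.erase i) else 0 := by
  rw [grMul]
  split_ifs with hi
  · rw [Finset.sum_eq_single {i}]
    · have h : ∀ (i : Fin 4) (S : Finset (Fin 4)), i ∈ S →
          (({i} ×ˢ (S \ {i})).filter fun p : Fin 4 × Fin 4 => p.2 < p.1).card
            = (S.filter fun j => j < i).card := by decide
      rw [grSign, h i S hi]
      simp [grGen, genSign, Finset.sdiff_singleton_eq_erase]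
    · intro T _ hT
      simp [grGen, Pi.single_eq_of_ne hT]
    · intro h
      simp [hi] at h
  · refine Finset.sum_eq_zero fun T hT => ?_
    have hT' : T ≠ {i} := by
      rintro rfl
      simp [hi] at hT
    simp [grGen, Pi.single_eq_of_ne hT']

theorem grLeftDeriv_apply (i : Fin 4) (Ψ : Gr) (S : Finset (Fin 4)) :
    grLeftDeriv i Ψ S = if i ∈ S then 0 else (genSign i S : ℂ) * Ψ (insert i S) := by
  simp [grLeftDeriv, genSign]

/-- Multiplication by a generator. -/
noncomputable def crea (i : Fin 4) : Gr →L[ℂ] Gr := LinearMap.toContinuousLinearMap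
  { toFun := grMul (grGen i)
    map_add' := fun Ψ Υ => by
      ext S; simp only [Pi.add_apply, grMul_grGen_apply]; split_ifs <;> ring
    map_smul' := fun c Ψ => by
      ext S
      simp only [Pi.smul_apply, grMul_grGen_apply, smul_eq_mul, RingHom.id_apply]
      split_ifs <;> ring }

/-- The left derivative with respect to a generator. -/
noncomputable def anni (i : Fin 4) : Gr →L[ℂ] Gr := LinearMap.toContinuousLinearMap
  { toFun := grLeftDeriv i
    map_add' := fun Ψ Υ => by
      ext S; simp only [Pi.add_apply, grLeftDeriv_apply]; split_ifs <;> ring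
    map_smul' := fun c Ψ => by
      ext S
      simp only [Pi.smul_apply, grLeftDeriv_apply, smul_eq_mul, RingHom.id_apply]
      split_ifs <;> ring }

theorem grMul_grGen (i : Fin 4) (Ψ : Gr) : grMul (grGen i) Ψ = crea i Ψ := rfl

theorem crea_apply (i : Fin 4) (Ψ : Gr) (S : Finset (Fin 4)) :
    crea i Ψ S = if i ∈ S then (genSign i S : ℂ) * Ψ (S.erase i) else 0 :=
  grMul_grGen_apply i Ψ S

theorem anni_apply (i : Fin 4) (Ψ : Gr) (S : Finset (Fin 4)) :
    anni i Ψ S = if i ∈ S then 0 else (genSign i S : ℂ) * Ψ (insert i S) :=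
  grLeftDeriv_apply i Ψ S

/-- Coefficient by coefficient, this and the other anticommutation relations are sign identities
over subsets of `Fin 4`. They are settled by `decide`, which is why `genSign` takes values in `ℤ`.
-/
theorem crea_crea (i j : Fin 4) (Ψ : Gr) : crea i (crea j Ψ) = -crea j (crea i Ψ) := by
  ext S
  have h : ∀ (i j : Fin 4) (S : Finset (Fin 4)), i ≠ j → i ∈ S → j ∈ S →
      genSign i S * genSign j (S.erase i) = -(genSign j S * genSign i (S.erase j)) := by decide
  rcases eq_or_ne i j with rfl | hij
  · simp [crea_apply]
  · by_cases hi : i ∈ S <;> by_cases hj : j ∈ S <;>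
      simp only [crea_apply, Pi.neg_apply, Finset.mem_erase, hi, hj, hij, hij.symm, ne_eq,
        not_false_eq_true, and_true, and_false, if_true, if_false, mul_zero, neg_zero]
    have h1 : (genSign i S * genSign j (S.erase i) : ℂ)
        = -(genSign j S * genSign i (S.erase j)) := by exact_mod_cast h i j S hij hi hj
    rw [← mul_assoc, h1, Finset.erase_right_comm]
    ring

theorem crea_self (i : Fin 4) (Ψ : Gr) : crea i (crea i Ψ) = 0 := by
  ext S
  simp [crea_apply]

theorem anni_crea_of_ne {i j : Fin 4} (hij : i ≠ j) (Ψ : Gr) :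
    anni i (crea j Ψ) = -crea j (anni i Ψ) := by
  ext S
  have h : ∀ (i j : Fin 4) (S : Finset (Fin 4)), i ≠ j → i ∉ S → j ∈ S →
      genSign i S * genSign j (insert i S) = -(genSign j S * genSign i (S.erase j)) := by decide
  by_cases hi : i ∈ S <;> by_cases hj : j ∈ S <;>
    simp only [crea_apply, anni_apply, Pi.neg_apply, Finset.mem_erase, Finset.mem_insert, hi, hj,
      hij, hij.symm, ne_eq, not_false_eq_true, and_true, and_false, if_true, if_false, mul_zero,
      neg_zero, or_true, or_false]
  have h1 : (genSign i S * genSign j (insert i S) : ℂ)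
      = -(genSign j S * genSign i (S.erase j)) := by exact_mod_cast h i j S hij hi hj
  rw [← mul_assoc, h1, Finset.erase_insert_of_ne hij]
  ring

theorem anni_crea_self (i : Fin 4) (Ψ : Gr) : anni i (crea i Ψ) = Ψ - crea i (anni i Ψ) := by
  ext S
  have h : ∀ (i : Fin 4) (S : Finset (Fin 4)), i ∉ S →
      genSign i S * genSign i (insert i S) = 1 := by decide
  have h' : ∀ (i : Fin 4) (S : Finset (Fin 4)), i ∈ S →
      genSign i S * genSign i (S.erase i) = 1 := by decide
  by_cases hi : i ∈ S
  · have h1 : (genSign i S * genSign i (S.erase i) : ℂ) = 1 := by exact_mod_cast h' i S hi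
    simp [crea_apply, anni_apply, hi, ← mul_assoc, h1]
  · have h1 : (genSign i S * genSign i (insert i S) : ℂ) = 1 := by exact_mod_cast h i S hi
    simp [crea_apply, anni_apply, hi, ← mul_assoc, h1]

theorem anni_anni (i j : Fin 4) (Ψ : Gr) : anni i (anni j Ψ) = -anni j (anni i Ψ) := by
  ext S
  have h : ∀ (i j : Fin 4) (S : Finset (Fin 4)), i ≠ j → i ∉ S → j ∉ S →
      genSign i S * genSign j (insert i S) = -(genSign j S * genSign i (insert j S)) := by decide
  rcases eq_or_ne i j with rfl | hij
  · simp [anni_apply]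
  · by_cases hi : i ∈ S <;> by_cases hj : j ∈ S <;>
      simp only [anni_apply, Pi.neg_apply, Finset.mem_insert, hi, hj, hij, hij.symm, if_true,
        if_false, mul_zero, neg_zero, or_true, or_false]
    have h1 : (genSign i S * genSign j (insert i S) : ℂ)
        = -(genSign j S * genSign i (insert j S)) := by exact_mod_cast h i j S hij hi hj
    rw [← mul_assoc, h1, Finset.insert_comm]
    ring

/-- The unit of the Grassmann algebra. -/
noncomputable def vac : Gr := Pi.single ∅ 1

theorem anni_vac (i : Fin 4) : anni i vac = 0 := by
  ext S
  simp [anni_apply, vac]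

theorem berezin_vac : berezin vac = 0 := by
  simp [berezin, vac, Finset.univ_eq_empty_iff]

theorem berezin_crea_crea_vac (i j : Fin 4) : berezin (crea i (crea j vac)) = 0 := by
  have h : ∀ i j : Fin 4, (Finset.univ.erase i).erase j ≠ ∅ := by decide
  simp [berezin, crea_apply, vac, h]

theorem berezin_top : berezin (crea 0 (crea 1 (crea 2 (crea 3 vac)))) = 1 := by
  have h0 : genSign 0 Finset.univ = 1 := by decide
  have h1 : genSign 1 (Finset.univ.erase 0) = 1 := by decide
  have h2 : genSign 2 ((Finset.univ.erase 0).erase 1) = 1 := by decide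
  have h3 : genSign 3 (((Finset.univ.erase 0).erase 1).erase 2) = 1 := by decide
  have h4 : (((Finset.univ.erase (0 : Fin 4)).erase 1).erase 2).erase 3 = ∅ := by decide
  rw [berezin, crea_apply, if_pos (by decide), crea_apply, if_pos (by decide), crea_apply,
    if_pos (by decide), crea_apply, if_pos (by decide), h0, h1, h2, h3, h4, vac, Pi.single_eq_same]
  norm_num

theorem ghostFree_eq (ψ : Conf → ℂ) (z : Conf × Mult) : ghostFree ψ z = ψ z.1 • vac := by
  ext S
  simp [ghostFree, vac, Pi.single_apply]

/-- A ghost-free left factor has only the coefficient at `∅`, so the Berezin integral sees only the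
top coefficient of `Υ`. -/
theorem brstDensity_ghostFree (ψ : Conf → ℂ) (Υ : Wave) (z : Conf × Mult) :
    brstDensity (ghostFree ψ) Υ z = (starRingEnd ℂ) (ψ z.1) * berezin (Υ z) := by
  rw [brstDensity, berezin, grMul, Finset.sum_eq_single ∅]
  · simp [grSign, grStar, ghostFree, berezin]
  · intro T _ hT
    simp [grStar, ghostFree, Pi.single_eq_of_ne hT]
  · simp

end Grassmann

end BRST

namespace BRST

/-! ### The commutator of the BRST operator and the gauge fixing fermion -/

section Commutator

variable (M N : Conf → ℝ)

/-- Half the divergence of the gauge vector field. -/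
noncomputable def halfDiv (z : Conf × Mult) : ℝ :=
  (z.2 0 * pd 0 M z.1 + z.2 1 * pd 1 N z.1) / 2

/-- The gauge vector field on the space of the `(q, λ)`. -/
noncomputable def liftField (z : Conf × Mult) : Conf × Mult := (gaugeField M N z.2 z.1, 0)

/-- The fermionic part of `i [Ω̂, ϱ̂]`. -/
noncomputable def fermOp (z : Conf × Mult) : Gr →L[ℂ] Gr :=
  ((trU M N z / 2 : ℝ) : ℂ) • 1
    - ∑ c, ∑ b, (uMat M N z.1 z.2 c b : ℂ) • (crea (Fin.castAdd 2 c) * anni (Fin.castAdd 2 b))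
    - ∑ a, crea (Fin.castAdd 2 a) * crea (Fin.natAdd 2 a)

variable {M N}

theorem gaugeField_eq (l : Mult) (q : Conf) : gaugeField M N l q
    = ∑ a : Fin 2, (l a * scale M N a q) • Pi.single a.castSucc (1 : ℝ) := by
  ext i
  have c0 : Fin.castSucc (0 : Fin 2) = (0 : Fin 3) := rfl
  have c1 : Fin.castSucc (1 : Fin 2) = (1 : Fin 3) := rfl
  rw [Fin.sum_univ_two, c0, c1]
  fin_cases i <;> simp [gaugeField, scale]

/-- The factor `i` cancels the `-i` of the constraints and leaves a real transport operator; the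
symmetric ordering contributes half the divergence. -/
theorem iLamPhi_eq (l : Mult) (χ : Conf → ℂ) (q : Conf) :
    iLamPhi M N l χ q = fderiv ℝ χ q (gaugeField M N l q) + halfDiv M N (q, l) * χ q := by
  have c0 : Fin.castSucc (0 : Fin 2) = (0 : Fin 3) := rfl
  have c1 : Fin.castSucc (1 : Fin 2) = (1 : Fin 3) := rfl
  have s0 : scale M N 0 = M := rfl
  have s1 : scale M N 1 = N := rfl
  rw [gaugeField_eq, iLamPhi]
  simp only [phiOp, pd, Fin.sum_univ_two, map_add, map_smul, halfDiv, c0, c1, s0, s1,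
    Complex.real_smul]
  push_cast
  linear_combination (-(l 0 : ℂ) * M q * fderiv ℝ χ q (Pi.single 0 1)
    - (l 1 : ℂ) * N q * fderiv ℝ χ q (Pi.single 1 1)
    - (l 0 : ℂ) * fderiv ℝ M q (Pi.single 0 1) * χ q / 2
    - (l 1 : ℂ) * fderiv ℝ N q (Pi.single 1 1) * χ q / 2) * Complex.I_sq

theorem fderiv_comp_mk {F : Type*} [NormedAddCommGroup F] [NormedSpace ℝ F]
    {Φ : Conf × Mult → F} {z : Conf × Mult} (h : DifferentiableAt ℝ Φ z) (X : Conf) :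
    fderiv ℝ (fun q => Φ (q, z.2)) z.1 X = fderiv ℝ Φ z (X, 0) := by
  have h1 : HasFDerivAt (fun q : Conf => (q, z.2)) (ContinuousLinearMap.inl ℝ Conf Mult) z.1 :=
    hasFDerivAt_prodMk_left z.1 z.2
  have h2 : HasFDerivAt Φ (fderiv ℝ Φ z) (z.1, z.2) := h.hasFDerivAt
  have h3 : HasFDerivAt (fun q => Φ (q, z.2)) _ z.1 := h2.comp z.1 h1
  rw [h3.fderiv]
  simp

theorem iLamPhiJoint_eq {Φ : Conf × Mult → ℂ} {z : Conf × Mult} (h : DifferentiableAt ℝ Φ z) :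
    iLamPhiJoint M N Φ z = fderiv ℝ Φ z (liftField M N z) + halfDiv M N z * Φ z := by
  rw [iLamPhiJoint, iLamPhi_eq, fderiv_comp_mk h]
  rfl

theorem fderiv_gr_apply {E : Type*} [NormedAddCommGroup E] [NormedSpace ℝ E] {Ψ : E → Gr} {z : E}
    (h : DifferentiableAt ℝ Ψ z) (X : E) (S : Finset (Fin 4)) :
    fderiv ℝ (fun y => Ψ y S) z X = fderiv ℝ Ψ z X S := by
  have := (ContinuousLinearMap.proj (R := ℝ) (φ := fun _ : Finset (Fin 4) => ℂ) S).hasFDerivAt.comp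
    z h.hasFDerivAt
  exact congr_arg (fun L => L X) this.fderiv

theorem wPhi_eq {a : Fin 2} {Ψ : Wave} {z : Conf × Mult}
    (h : DifferentiableAt ℝ (fun q => Ψ (q, z.2)) z.1) :
    wPhi M N a Ψ z = -Complex.I • ((scale M N a z.1 : ℂ) •
      fderiv ℝ (fun q => Ψ (q, z.2)) z.1 (Pi.single a.castSucc 1)
        + ((1 / 2 : ℂ) * ((pd a.castSucc (scale M N a) z.1 : ℝ) : ℂ)) • Ψ z) := by
  ext S
  simp [wPhi, phiOp, pd, ← fderiv_gr_apply h]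

/-- The constraint operators commute with the operators on the Grassmann algebra. -/
theorem wPhi_clm {a : Fin 2} {Ψ : Wave} {z : Conf × Mult}
    (h : DifferentiableAt ℝ (fun q => Ψ (q, z.2)) z.1) (T : Mult → Gr →L[ℂ] Gr) :
    wPhi M N a (fun y => T y.2 (Ψ y)) z = T z.2 (wPhi M N a Ψ z) := by
  have h1 := ((T z.2).restrictScalars ℝ).hasFDerivAt.comp z.1 h.hasFDerivAt
  have h2 : HasFDerivAt (fun q => T z.2 (Ψ (q, z.2))) _ z.1 := h1
  rw [wPhi_eq h, wPhi_eq (Ψ := fun y => T y.2 (Ψ y)) h2.differentiableAt, h2.fderiv]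
  simp

theorem wPi_eq {a : Fin 2} {Ψ : Wave} {z : Conf × Mult}
    (h : DifferentiableAt ℝ (fun l => Ψ (z.1, l)) z.2) :
    wPi a Ψ z = -Complex.I • fderiv ℝ (fun l => Ψ (z.1, l)) z.2 (Pi.single a 1) := by
  ext S
  simp [wPi, pd, ← fderiv_gr_apply h]

/-- The gauge fixing fermion as an operator on the Grassmann algebra. -/
noncomputable def fermionOp (l : Mult) : Gr →L[ℂ] Gr :=
  Complex.I • ∑ a, (l a : ℂ) • crea (Fin.castAdd 2 a)

theorem gaugeFermion_eq (Ψ : Wave) : gaugeFermion Ψ = fun z => fermionOp z.2 (Ψ z) := by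
  ext z S
  simp [gaugeFermion, fermionOp, wRhoBar, grMul_grGen, Fin.sum_univ_two, mul_add]

/-- The fermion `ϱ̂` is linear in `λ`, so the Leibniz rule produces an extra `ρ̄_a`: the source of
the term `-ρ̄_a ρ^a` of `fermOp`. -/
theorem wPi_gaugeFermion {a : Fin 2} {Ψ : Wave} {z : Conf × Mult}
    (h : DifferentiableAt ℝ (fun l => Ψ (z.1, l)) z.2) :
    wPi a (gaugeFermion Ψ) z
      = fermionOp z.2 (wPi a Ψ z) + crea (Fin.castAdd 2 a) (Ψ z) := by
  have h1 : ∀ b : Fin 2, HasFDerivAt (fun l : Mult => (l b : ℂ) • crea (Fin.castAdd 2 b)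
      (Ψ (z.1, l))) ((z.2 b : ℂ) • (((crea (Fin.castAdd 2 b)).restrictScalars ℝ).comp
        (fderiv ℝ (fun l => Ψ (z.1, l)) z.2)) + ((Complex.ofRealCLM.comp
        (ContinuousLinearMap.proj (R := ℝ) (φ := fun _ : Fin 2 => ℝ) b)).smulRight
          (crea (Fin.castAdd 2 b) (Ψ z)))) z.2 := fun b => by
    have h1 : HasFDerivAt (fun l : Mult => (l b : ℂ)) (Complex.ofRealCLM.comp
        (ContinuousLinearMap.proj (R := ℝ) (φ := fun _ : Fin 2 => ℝ) b)) z.2 :=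
      (Complex.ofRealCLM.comp (ContinuousLinearMap.proj (R := ℝ)
        (φ := fun _ : Fin 2 => ℝ) b)).hasFDerivAt
    have h2 : HasFDerivAt (fun l : Mult => crea (Fin.castAdd 2 b) (Ψ (z.1, l))) _ z.2 :=
      ((crea (Fin.castAdd 2 b)).restrictScalars ℝ).hasFDerivAt.comp z.2 h.hasFDerivAt
    exact h1.smul h2
  have h3 : (fun l => gaugeFermion Ψ (z.1, l)) = Complex.I •
      ((fun l : Mult => (l 0 : ℂ) • crea (Fin.castAdd 2 0) (Ψ (z.1, l)))
        + fun l : Mult => (l 1 : ℂ) • crea (Fin.castAdd 2 1) (Ψ (z.1, l))) := by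
    ext l S
    simp [gaugeFermion, wRhoBar, grMul_grGen, Fin.sum_univ_two]
  have h4 := ((h1 0).add (h1 1)).const_smul Complex.I
  rw [← h3] at h4
  rw [wPi_eq h, wPi_eq h4.differentiableAt, h4.fderiv]
  ext S
  fin_cases a <;>
  · simp [fermionOp, Fin.sum_univ_two]
    linear_combination (-crea _ (Ψ z) S) * Complex.I_sq

/-- The terms with `λ`-derivatives of `Ψ` cancel because `ρ^a` and `ρ̄_b` anticommute. The
anticommutator of `Ĉ^a` and `ρ̄_b` turns the linear part of `Ω̂` into `iλ^a φ̂_a + s/2` and its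
cubic part into the action of `-u` on the `ρ̄`. -/
theorem iOmegaRho_eq_sum {Ψ : Wave} {z : Conf × Mult} (h : DifferentiableAt ℝ Ψ z) :
    iOmegaRho M N Ψ z
      = ∑ a, (Complex.I * (z.2 a : ℂ)) • wPhi M N a Ψ z + fermOp M N z (Ψ z) := by
  have hq : DifferentiableAt ℝ (fun q => Ψ (q, z.2)) z.1 :=
    DifferentiableAt.comp (f := fun q : Conf => (q, z.2)) z.1 h (by fun_prop)
  have hl : DifferentiableAt ℝ (fun l => Ψ (z.1, l)) z.2 :=
    DifferentiableAt.comp (f := fun l : Mult => (z.1, l)) z.2 h (by fun_prop)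
  have e1 : ∀ a, wPhi M N a (wC a (gaugeFermion Ψ)) z
      = -Complex.I • anni (Fin.castAdd 2 a) (fermionOp z.2 (wPhi M N a Ψ z)) := fun a => by
    rw [gaugeFermion_eq]
    exact wPhi_clm (M := M) (N := N) (a := a) hq
      (fun l => -Complex.I • (anni (Fin.castAdd 2 a) * fermionOp l))
  have e2 : ∀ a, wPhi M N a (wC a Ψ) z = -Complex.I • anni (Fin.castAdd 2 a) (wPhi M N a Ψ z) :=
    fun a => wPhi_clm (M := M) (N := N) (a := a) hq
      (fun l => -Complex.I • anni (Fin.castAdd 2 a))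
  have e3 : ∀ a, wRho a (wPi a (gaugeFermion Ψ)) z = crea (Fin.natAdd 2 a)
      (fermionOp z.2 (wPi a Ψ z) + crea (Fin.castAdd 2 a) (Ψ z)) := fun a => by
    rw [wRho, wPi_gaugeFermion hl, grMul_grGen]
  have e4 : ∀ a, wC a (gaugeFermion Ψ) z
      = -Complex.I • anni (Fin.castAdd 2 a) (fermionOp z.2 (Ψ z)) := fun a => by
    rw [gaugeFermion_eq]; rfl
  have e5 : ∀ a b c, wRhoBar c (wC a (wC b (gaugeFermion Ψ))) z = crea (Fin.castAdd 2 c)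
      (-Complex.I • anni (Fin.castAdd 2 a)
        (-Complex.I • anni (Fin.castAdd 2 b) (fermionOp z.2 (Ψ z)))) := fun a b c => by
    rw [gaugeFermion_eq]; rfl
  have e6 : gaugeFermion (Omega M N Ψ) z = fermionOp z.2 (Omega M N Ψ z) := by
    rw [gaugeFermion_eq]
  have e7 : ∀ a b c, wRhoBar c (wC a (wC b Ψ)) z = crea (Fin.castAdd 2 c)
      (-Complex.I • anni (Fin.castAdd 2 a) (-Complex.I • anni (Fin.castAdd 2 b) (Ψ z))) :=
    fun a b c => rfl
  have e8 : ∀ a, wRho a (wPi a Ψ) z = crea (Fin.natAdd 2 a) (wPi a Ψ z) := fun a => rfl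
  have e9 : ∀ a, wC a Ψ z = -Complex.I • anni (Fin.castAdd 2 a) (Ψ z) := fun a => rfl
  rw [iOmegaRho, e6, Omega, Omega]
  simp only [e1, e2, e3, e4, e5, e7, e8, e9]
  -- From here on all derivatives are fixed elements of the Grassmann algebra, and the identity is
  -- pure algebra.
  generalize wPhi M N = D
  generalize wPi = P
  generalize Ψ z = v
  have c0 : Fin.castAdd 2 (0 : Fin 2) = (0 : Fin 4) := rfl
  have c1 : Fin.castAdd 2 (1 : Fin 2) = (1 : Fin 4) := rfl
  have c2 : Fin.natAdd 2 (0 : Fin 2) = (2 : Fin 4) := rfl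
  have c3 : Fin.natAdd 2 (1 : Fin 2) = (3 : Fin 4) := rfl
  simp only [Fin.sum_univ_two, c0, c1, c2, c3, fermionOp, fermOp, structFn_eq, uMat_eq, trU,
    map_add, map_sub, map_smul, add_apply, sub_apply,
    smul_apply, mul_apply_eq_comp, one_apply_eq_self]
  have v0 : (!![0, 1; -1, 0] : Matrix (Fin 2) (Fin 2) ℝ) 0 0 = 0 := rfl
  have v1 : (!![0, 1; -1, 0] : Matrix (Fin 2) (Fin 2) ℝ) 0 1 = 1 := rfl
  have v2 : (!![0, 1; -1, 0] : Matrix (Fin 2) (Fin 2) ℝ) 1 0 = -1 := rfl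
  have v3 : (!![0, 1; -1, 0] : Matrix (Fin 2) (Fin 2) ℝ) 1 1 = 0 := rfl
  simp only [v0, v1, v2, v3, Matrix.of_apply, Matrix.cons_val_zero, Matrix.cons_val_one, zero_mul,
    Complex.ofReal_zero, zero_smul, zero_add, add_zero]
  -- Normal ordering: annihilators move to the right, and generators are sorted by index.
  simp only [anni_crea_self, anni_crea_of_ne (show (0 : Fin 4) ≠ 1 by decide),
    anni_crea_of_ne (show (1 : Fin 4) ≠ 0 by decide), crea_crea 1 0, crea_crea 2 0, crea_crea 2 1,
    crea_crea 3 0, crea_crea 3 1, anni_anni 1 0, crea_self, map_sub, map_neg,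
    smul_zero, neg_zero, sub_zero, add_zero, zero_add, neg_neg]
  push_cast
  match_scalars <;> ring_nf <;> simp only [Complex.I_sq, Complex.I_pow_three, Complex.I_pow_four]
    <;> ring

/-- The operator `i [Ω̂, ϱ̂]`: transport along the gauge vector field and an action on the fermions. -/
theorem iOmegaRho_eq {Ψ : Wave} {z : Conf × Mult} (h : DifferentiableAt ℝ Ψ z) :
    iOmegaRho M N Ψ z = fderiv ℝ Ψ z (liftField M N z)
      + ((halfDiv M N z : ℂ) • Ψ z + fermOp M N z (Ψ z)) := by
  rw [iOmegaRho_eq_sum h, ← add_assoc]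
  congr 1
  ext S
  have hS : DifferentiableAt ℝ (fun y => Ψ y S) z := differentiableAt_pi.1 h S
  have h1 := iLamPhiJoint_eq (M := M) (N := N) hS
  rw [iLamPhiJoint, iLamPhi, fderiv_gr_apply h] at h1
  simpa [wPhi, Fin.sum_univ_two, mul_add, mul_assoc] using h1

end Commutator

end BRST

namespace BRST

/-! ### The fermionic factor of the evolution -/

section Ghost

variable (M N : Conf → ℝ)

/-- The matrix `-(1 - e^{-tu}) / u`. -/
noncomputable def ghostMat (t : ℝ) (z : Conf × Mult) (a b : Fin 2) : ℝ :=
  expPrim₂ t (trU M N z) * uMat M N z.1 z.2 a b - t * (1 : Matrix (Fin 2) (Fin 2) ℝ) a b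

/-- The element `e^{t tr u / 2} exp (-ρ̄ ((1 - e^{-tu}) / u) ρ)` of the Grassmann algebra. -/
noncomputable def ghost (t : ℝ) (z : Conf × Mult) : Gr :=
  (Real.exp (t * (trU M N z / 2)) : ℂ) • (vac
    + ∑ a, ∑ b, (ghostMat M N t z a b : ℂ) • crea (Fin.castAdd 2 a) (crea (Fin.natAdd 2 b) vac)
    - ((t * expPrim t (trU M N z) : ℝ) : ℂ) • crea 0 (crea 1 (crea 2 (crea 3 vac))))

variable {M N}

theorem hasDerivAt_ofReal_smul {f : ℝ → ℝ} {f' t : ℝ} (hf : HasDerivAt f f' t) (v : Gr) :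
    HasDerivAt (fun t => (f t : ℂ) • v) ((f' : ℂ) • v) t :=
  hf.ofReal_comp.smul_const v

/-- For `e^{ts/2} exp(ρ̄ B ρ)` the fermionic equation is the matrix equation `B' = -1 - u B`, whose
solution vanishing at `0` is `B = -(1 - e^{-tu}) / u`. The quartic coefficient is `-det B = -t (1 -
e^{-ts}) / s`. -/
theorem hasDerivAt_ghost (t : ℝ) (z : Conf × Mult) :
    HasDerivAt (fun t => ghost M N t z) (fermOp M N z (ghost M N t z)) t := by
  have hB : ∀ a b, HasDerivAt (fun t => ghostMat M N t z a b)
      (expPrim t (trU M N z) * uMat M N z.1 z.2 a b - 1 * (1 : Matrix (Fin 2) (Fin 2) ℝ) a b) t :=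
    fun a b => ((hasDerivAt_expPrim₂ t _).mul_const _).sub ((hasDerivAt_id t).mul_const _)
  have hD : HasDerivAt (fun t => t * expPrim t (trU M N z)) (1 * expPrim t (trU M N z)
      + t * (1 - trU M N z * expPrim t (trU M N z))) t :=
    (hasDerivAt_id t).mul (hasDerivAt_expPrim t _)
  have hE : HasDerivAt (fun t => ((Real.exp (t * (trU M N z / 2)) : ℝ) : ℂ))
      ((Real.exp (t * (trU M N z / 2)) * (1 * (trU M N z / 2)) : ℝ) : ℂ) t :=
    (((hasDerivAt_id t).mul_const (trU M N z / 2)).exp).ofReal_comp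
  have hS := ((HasDerivAt.fun_sum (u := Finset.univ) fun a _ =>
    HasDerivAt.fun_sum (u := Finset.univ) fun b _ =>
      hasDerivAt_ofReal_smul (hB a b) (crea (Fin.castAdd 2 a) (crea (Fin.natAdd 2 b) vac))).const_add
        vac).sub (hasDerivAt_ofReal_smul hD (crea 0 (crea 1 (crea 2 (crea 3 vac)))))
  refine (hE.smul hS).congr_deriv ?_
  have hs : ((trU M N z : ℝ) : ℂ) = coef M N 1 z.1 * z.2 0 - coef M N 0 z.1 * z.2 1 := by
    simp [trU]
  -- Apart from the derivatives above, this is the only relation between the special functions that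
  -- the comparison of coefficients needs.
  have hH : ((trU M N z : ℝ) : ℂ) * (expPrim₂ t (trU M N z) : ℂ) = t - (expPrim t (trU M N z) : ℂ) :=
    mod_cast mul_expPrim₂ t (trU M N z)
  have c0 : Fin.castAdd 2 (0 : Fin 2) = (0 : Fin 4) := rfl
  have c1 : Fin.castAdd 2 (1 : Fin 2) = (1 : Fin 4) := rfl
  have c2 : Fin.natAdd 2 (0 : Fin 2) = (2 : Fin 4) := rfl
  have c3 : Fin.natAdd 2 (1 : Fin 2) = (3 : Fin 4) := rfl
  have o1 : (1 : Matrix (Fin 2) (Fin 2) ℝ) 0 1 = 0 := rfl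
  have o2 : (1 : Matrix (Fin 2) (Fin 2) ℝ) 1 0 = 0 := rfl
  simp only [ghost, fermOp, ghostMat, Fin.sum_univ_two, c0, c1, c2, c3, o1, o2, uMat_eq,
    Matrix.one_apply_eq, Matrix.of_apply, Matrix.cons_val_zero, Matrix.cons_val_one,
    Pi.sub_apply, sub_apply, add_apply, smul_apply, mul_apply_eq_comp, one_apply_eq_self,
    map_add, map_sub, map_smul]
  simp only [anni_crea_self, anni_crea_of_ne (show (0 : Fin 4) ≠ 1 by decide),
    anni_crea_of_ne (show (1 : Fin 4) ≠ 0 by decide), anni_crea_of_ne (show (0 : Fin 4) ≠ 2 by decide),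
    anni_crea_of_ne (show (0 : Fin 4) ≠ 3 by decide), anni_crea_of_ne (show (1 : Fin 4) ≠ 2 by decide),
    anni_crea_of_ne (show (1 : Fin 4) ≠ 3 by decide), anni_vac, crea_crea 1 0, crea_crea 2 0,
    crea_crea 2 1, crea_crea 3 0, crea_crea 3 1, crea_crea 3 2, crea_self, map_neg, map_zero,
    smul_zero, neg_zero, sub_zero, add_zero, zero_add, neg_neg]
  rw [hs] at hH
  generalize Real.exp (t * (trU M N z / 2)) = E
  push_cast
  rw [hs]
  generalize (expPrim t (trU M N z) : ℂ) = h at *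
  generalize (expPrim₂ t (trU M N z) : ℂ) = H at *
  generalize (coef M N 0 z.1 : ℂ) = α at *
  generalize (coef M N 1 z.1 : ℂ) = β at *
  generalize (z.2 0 : ℂ) = l at *
  generalize (z.2 1 : ℂ) = m at *
  match_scalars
  · linear_combination (-E * α * m) * hH
  · linear_combination (E * α * l) * hH
  · linear_combination (-E * β * m) * hH
  · linear_combination (E * β * l) * hH
  · linear_combination (-E : ℂ) * hH
  · ring

theorem ghost_zero (z : Conf × Mult) : ghost M N 0 z = vac := by
  simp [ghost, ghostMat, expPrim₂]

/-- Only the quartic term contributes, with `e^{s/2} (1 - e^{-s}) / s = e^{-s/2} expQuot s`. The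
sign comes from sorting `ρ̄₁ρ¹ρ̄₂ρ²` into `ρ̄₁ρ̄₂ρ¹ρ²`, and it is what the constant `c = -1` of the
form compensates. -/
theorem berezin_ghost_one (z : Conf × Mult) :
    berezin (ghost M N 1 z) = -(j0 (uMat M N z.1 z.2) : ℂ) := by
  have h1 : ∀ a b : Fin 2, crea (Fin.castAdd 2 a) (crea (Fin.natAdd 2 b) vac) Finset.univ = 0 :=
    fun a b => berezin_crea_crea_vac _ _
  have h2 : vac Finset.univ = 0 := berezin_vac
  have h3 : crea 0 (crea 1 (crea 2 (crea 3 vac))) Finset.univ = 1 := berezin_top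
  have h4 : Real.exp (trU M N z / 2) * Real.exp (-trU M N z)
      = Real.exp (-(trU M N z / 2)) := by
    rw [← Real.exp_add]; congr 1; ring
  simp only [berezin, ghost, Pi.smul_apply, Pi.add_apply, Pi.sub_apply, Finset.sum_apply, h1, h2,
    h3, smul_eq_mul, mul_zero, Finset.sum_const_zero, j0_uMat, expPrim, one_mul, expQuot_neg]
  rw [← h4]
  push_cast
  ring

/-- The fermionic factor depends on `q` through `x` only. -/
theorem ghost_congr (hx : ∀ (a b c : Fin 2) (q q' : Conf), q 2 = q' 2 →
      structFn M N a b c q = structFn M N a b c q') (t : ℝ) {z z' : Conf × Mult}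
    (h : z.1 2 = z'.1 2) (h' : z.2 = z'.2) : ghost M N t z = ghost M N t z' := by
  have h1 : uMat M N z.1 z.2 = uMat M N z'.1 z'.2 := by
    ext a b
    simp only [uMat, Matrix.of_apply, h', hx _ _ _ _ _ h]
  have h2 : trU M N z = trU M N z' := by
    rw [← trace_uMat z.1 z.2, h1, trace_uMat]
  simp only [ghost, ghostMat, h1, h2]

theorem contDiff_ghost (hM : ContDiff ℝ ∞ M) (hN : ContDiff ℝ ∞ N) (hMpos : ∀ q, 0 < M q)
    (hNpos : ∀ q, 0 < N q) :
    ContDiff ℝ 1 fun p : ℝ × (Conf × Mult) => ghost M N p.1 p.2 := by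
  have hc : ∀ a, ContDiff ℝ 1 fun p : ℝ × (Conf × Mult) => coef M N a p.2.1 := fun a =>
    ((contDiff_coef hM hN hMpos hNpos a).of_le (by simp)).comp (by fun_prop)
  have hs : ContDiff ℝ 1 fun p : ℝ × (Conf × Mult) => trU M N p.2 :=
    ((hc 1).mul (by fun_prop)).sub ((hc 0).mul (by fun_prop))
  have hu : ∀ a b, ContDiff ℝ 1 fun p : ℝ × (Conf × Mult) => uMat M N p.2.1 p.2.2 a b := by
    intro a b
    simp only [uMat_eq, Matrix.of_apply]
    refine (hc a).mul ?_
    fin_cases b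
    · simp only [Fin.zero_eta, Matrix.cons_val_zero]; fun_prop
    · simp only [Fin.mk_one, Matrix.cons_val_one, Matrix.cons_val_fin_one]; fun_prop
  have h1 : ContDiff ℝ 1 fun p : ℝ × (Conf × Mult) => expPrim p.1 (trU M N p.2) :=
    contDiff_expPrim.comp (contDiff_fst.prodMk hs)
  have h2 : ContDiff ℝ 1 fun p : ℝ × (Conf × Mult) => expPrim₂ p.1 (trU M N p.2) :=
    contDiff_expPrim₂.comp (contDiff_fst.prodMk hs)
  have hof : ∀ {f : ℝ × (Conf × Mult) → ℝ}, ContDiff ℝ 1 f → ContDiff ℝ 1 fun p => (f p : ℂ) :=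
    fun hf => Complex.ofRealCLM.contDiff.comp hf
  refine (hof (contDiff_fst.mul (hs.div_const 2)).exp).smul
    ((contDiff_const.add (ContDiff.sum fun a _ => ContDiff.sum fun b _ => ?_)).sub ?_)
  · exact (hof ((h2.mul (hu a b)).sub (contDiff_fst.mul contDiff_const))).smul contDiff_const
  · exact (hof (contDiff_fst.mul h1)).smul contDiff_const

theorem fderiv_apply_eq_zero_of_line {E F : Type*} [NormedAddCommGroup E] [NormedSpace ℝ E]
    [NormedAddCommGroup F] [NormedSpace ℝ F] {f : E → F} {z X : E}
    (hf : DifferentiableAt ℝ f z) (h : ∀ t : ℝ, f (z + t • X) = f z) : fderiv ℝ f z X = 0 := by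
  have h1 := hf.hasFDerivAt.hasLineDerivAt X
  have h2 : HasDerivAt (fun t : ℝ => f (z + t • X)) (fderiv ℝ f z X) 0 := h1
  simp only [h] at h2
  exact h2.unique (hasDerivAt_const 0 (f z))

/-- The evolution of a wave function: the evolution of the ghost-free part times the fermionic
factor. -/
theorem isExpOrbit_smul_ghost (hM : ContDiff ℝ ∞ M) (hN : ContDiff ℝ ∞ N) (hMpos : ∀ q, 0 < M q)
    (hNpos : ∀ q, 0 < N q) (hx : ∀ (a b c : Fin 2) (q q' : Conf), q 2 = q' 2 →
      structFn M N a b c q = structFn M N a b c q') {χ : Conf → ℂ}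
    {Φ : ℝ → Conf × Mult → ℂ} (hΦ : IsExpOrbit (iLamPhiJoint M N) (fun z => χ z.1) Φ) :
    IsExpOrbit (iOmegaRho M N) (ghostFree χ) fun t z => Φ t z • ghost M N t z := by
  obtain ⟨h1, h2, h3⟩ := hΦ
  have hg := contDiff_ghost hM hN hMpos hNpos
  refine ⟨h1.smul hg, ?_, fun t z => ?_⟩
  · ext1 z
    simp only [h2, ghost_zero, ghostFree_eq]
  · have hp : DifferentiableAt ℝ (fun z : Conf × Mult => (t, z)) z := by fun_prop
    have d1 : DifferentiableAt ℝ (Φ t) z :=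
      ((h1.differentiable one_ne_zero) (t, z)).comp z hp
    have d2 : DifferentiableAt ℝ (ghost M N t) z :=
      ((hg.differentiable one_ne_zero) (t, z)).comp z hp
    have d3 : HasFDerivAt (𝕜 := ℝ) (fun z => Φ t z • ghost M N t z) _ z :=
      d1.hasFDerivAt.smul d2.hasFDerivAt
    -- The dependence of the structure functions on `x` alone enters here: the lifted field leaves
    -- both `x` and `λ` fixed.
    have d4 : fderiv ℝ (ghost M N t) z (liftField M N z) = 0 :=
      fderiv_apply_eq_zero_of_line d2 fun s => ghost_congr hx t
        (by simp [liftField, gaugeField]) (by simp [liftField])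
    have h5 := (h3 t z).smul (hasDerivAt_ghost (M := M) (N := N) t z)
    refine h5.congr_deriv ?_
    rw [iOmegaRho_eq d3.differentiableAt, d3.fderiv, iLamPhiJoint_eq d1]
    simp only [add_apply, smul_apply, d4, ContinuousLinearMap.smulRight_apply, map_smul]
    module

theorem brstDensity_smul_ghost (ψ : Conf → ℂ) (Φ : Conf × Mult → ℂ) (z : Conf × Mult) :
    -brstDensity (ghostFree ψ) (fun z => Φ z • ghost M N 1 z) z
      = (j0 (uMat M N z.1 z.2) : ℂ) * (starRingEnd ℂ) (ψ z.1) * Φ z := by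
  have h : berezin (Φ z • ghost M N 1 z) = Φ z * berezin (ghost M N 1 z) := rfl
  rw [brstDensity_ghostFree, h, berezin_ghost_one]
  ring

end Ghost

end BRST

/-! ### Transport equations along a global flow -/

section Transport

variable {E F : Type*} [NormedAddCommGroup E] [NormedSpace ℝ E] [NormedAddCommGroup F]
  [NormedSpace ℝ F] {Z : E → E} {φ : ℝ → E → E} {d : E → ℝ}

/-- The integral of `d` along the flow `φ`. -/
noncomputable def flowIntegral (φ : ℝ → E → E) (d : E → ℝ) (t : ℝ) (z : E) : ℝ :=
  ∫ τ in (0 : ℝ)..t, d (φ τ z)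

namespace IsGlobalFlow

theorem hasDerivAt_flowIntegral (h : IsGlobalFlow Z φ) (hd : Continuous d) (z : E) (t : ℝ) :
    HasDerivAt (fun s => flowIntegral φ d s z) (d (φ t z)) t :=
  ((hd.comp (h.continuous_time z)).integral_hasStrictDerivAt 0 t).hasDerivAt

/-- With the integral of `d` as one more coordinate of a flow, its smoothness and its cocycle
identity are instances of `contDiff` and `add`. -/
theorem flow_prodMk (h : IsGlobalFlow Z φ) (hd : Continuous d) :
    IsGlobalFlow (fun p : E × ℝ => (Z p.1, d p.1))
      (fun t p => (φ t p.1, p.2 + flowIntegral φ d t p.1)) where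
  zero p := by simp [h.zero, flowIntegral]
  hasDerivAt p t := (h.hasDerivAt p.1 t).prodMk ((h.hasDerivAt_flowIntegral hd p.1 t).const_add p.2)

variable [FiniteDimensional ℝ E]

theorem contDiff_flowIntegral (h : IsGlobalFlow Z φ) (hZ : ContDiff ℝ 1 Z) (hd : ContDiff ℝ 1 d) :
    ContDiff ℝ 1 fun p : ℝ × E => flowIntegral φ d p.1 p.2 := by
  have h1 := ((h.flow_prodMk hd.continuous).contDiff (by fun_prop)).snd
  have h2 : ContDiff ℝ 1 fun p : ℝ × E => (p.1, (p.2, (0 : ℝ))) := by fun_prop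
  simpa [Function.comp_def] using h1.comp h2

theorem flowIntegral_add (h : IsGlobalFlow Z φ) (hZ : ContDiff ℝ 1 Z) (hd : ContDiff ℝ 1 d)
    (s t : ℝ) (z : E) :
    flowIntegral φ d (s + t) z = flowIntegral φ d s (φ t z) + flowIntegral φ d t z := by
  have : ProperSpace (E × ℝ) := FiniteDimensional.proper_real _
  have h1 := congr_arg Prod.snd
    ((h.flow_prodMk hd.continuous).add (by fun_prop) s t (z, (0 : ℝ)))
  simp only [zero_add] at h1
  rw [← h1, add_comm]

/-- The solution of the transport equation `∂_t Φ = Z Φ + d Φ` with `Φ 0 = g`. -/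
theorem hasDerivAt_transport (h : IsGlobalFlow Z φ) (hZ : ContDiff ℝ 1 Z) (hd : ContDiff ℝ 1 d)
    {g : E → ℂ} (hg : ContDiff ℝ 1 g) :
    ContDiff ℝ 1 (fun p : ℝ × E => g (φ p.1 p.2) * (Real.exp (flowIntegral φ d p.1 p.2) : ℂ)) ∧
    ∀ t z, HasDerivAt (fun s => g (φ s z) * (Real.exp (flowIntegral φ d s z) : ℂ))
      (fderiv ℝ (fun z => g (φ t z) * (Real.exp (flowIntegral φ d t z) : ℂ)) z (Z z)
        + d z * (g (φ t z) * (Real.exp (flowIntegral φ d t z) : ℂ))) t := by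
  have : ProperSpace E := FiniteDimensional.proper_real _
  have hC : ContDiff ℝ 1
      (fun p : ℝ × E => g (φ p.1 p.2) * (Real.exp (flowIntegral φ d p.1 p.2) : ℂ)) :=
    (hg.comp (h.contDiff hZ)).mul
      (Complex.ofRealCLM.contDiff.comp (h.contDiff_flowIntegral hZ hd).exp)
  refine ⟨hC, fun t z => ?_⟩
  set Φ : ℝ → E → ℂ := fun t z => g (φ t z) * (Real.exp (flowIntegral φ d t z) : ℂ) with hΦ
  have hdiff : Differentiable ℝ fun p : ℝ × E => Φ p.1 p.2 := hC.differentiable one_ne_zero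
  have h1 : DifferentiableAt ℝ (fun s => Φ s z) t :=
    (hdiff (t, z)).comp (f := fun s : ℝ => (s, z)) t (by fun_prop : DifferentiableAt ℝ (fun s : ℝ => (s, z)) t)
  have h2 : DifferentiableAt ℝ (Φ t) z :=
    (hdiff (t, z)).comp (f := fun z : E => (t, z)) z
      (by fun_prop : DifferentiableAt ℝ (fun z : E => (t, z)) z)
  have h3 : HasDerivAt (fun s => Φ t (φ s z)) (fderiv ℝ (Φ t) z (Z z)) 0 := by
    have h4 := h.hasDerivAt z 0
    rw [h.zero] at h4
    refine HasFDerivAt.comp_hasDerivAt (l := Φ t) (f := fun s => φ s z) 0 ?_ h4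
    rw [h.zero]
    exact h2.hasFDerivAt
  have h5 : HasDerivAt (fun s => Φ (s + t) z * (Real.exp (-flowIntegral φ d s z) : ℂ))
      (deriv (fun s => Φ s z) t - d z * Φ t z) 0 := by
    have h6 : HasDerivAt (fun s => Φ (s + t) z) (deriv (fun s => Φ s z) t) 0 :=
      HasDerivAt.comp_add_const (f := fun s => Φ s z) 0 t (by rw [zero_add]; exact h1.hasDerivAt)
    have h7 := (h.hasDerivAt_flowIntegral hd.continuous z 0).neg.exp.ofReal_comp
    refine (h6.mul h7).congr_deriv ?_
    simp [flowIntegral, h.zero]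
    ring
  -- The cocycle identity trades the derivative along `Z` for the derivative in time: both sides are
  -- differentiated at `s = 0`.
  have h8 : (fun s => Φ t (φ s z))
      = fun s => Φ (s + t) z * (Real.exp (-flowIntegral φ d s z) : ℂ) := by
    ext s
    simp only [hΦ]
    rw [h.add hZ, add_comm s t, h.flowIntegral_add hZ hd, mul_assoc, ← Complex.ofReal_mul,
      ← Real.exp_add]
    simp
  rw [h8] at h3
  rw [h3.unique h5, sub_add_cancel]
  exact h1.hasDerivAt

end IsGlobalFlow

/-- Uniqueness for linear transport equations `∂_t Γ = Z Γ + b Γ` along a global flow. -/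
theorem IsGlobalFlow.isExpOrbit_unique (h : IsGlobalFlow Z φ) {A : (E → F) → E → F}
    {b : E → F → F} {κ : E → ℝ} (hκ : Continuous κ)
    (hb : ∀ z v w, ‖b z v - b z w‖ ≤ κ z * ‖v - w‖)
    (hA : ∀ Γ z, DifferentiableAt ℝ Γ z → A Γ z = fderiv ℝ Γ z (Z z) + b z (Γ z)) {g : E → F}
    {Γ Γ' : ℝ → E → F} (hΓ : BRST.IsExpOrbit A g Γ) (hΓ' : BRST.IsExpOrbit A g Γ') : Γ = Γ' := by
  ext t z
  -- Along `s ↦ (t - s, φ s z)` the transport term cancels and the linear equation `y' = -b y`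
  -- remains. Its value at `s = t` is `g (φ t z)`, and at `s = 0` it is `Γ t z`.
  have key : ∀ {Γ : ℝ → E → F}, BRST.IsExpOrbit A g Γ → ∀ s,
      HasDerivAt (fun s => Γ (t - s) (φ s z)) (-b (φ s z) (Γ (t - s) (φ s z))) s := by
    intro Γ hΓ s
    obtain ⟨h1, -, h3⟩ := hΓ
    have h4 := (h1.differentiable one_ne_zero (t - s, φ s z)).hasFDerivAt
    have h5 : HasDerivAt (fun s => (t - s, φ s z)) (-1, Z (φ s z)) s :=
      ((hasDerivAt_id s).const_sub t).prodMk (h.hasDerivAt z s)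
    refine (h4.comp_hasDerivAt s h5).congr_deriv ?_
    have h6 := (hasDerivAt_id (t - s)).prodMk (hasDerivAt_const (t - s) (φ s z))
    have h7 := (HasFDerivAt.comp_hasDerivAt (t - s) h4 h6).unique (h3 (t - s) (φ s z))
    have h8 : HasFDerivAt (Γ (t - s)) _ (φ s z) := h4.comp (φ s z)
      (hasFDerivAt_prodMk_right (t - s) (φ s z))
    rw [hA _ _ h8.differentiableAt, h8.fderiv] at h7
    have h9 : ((-1 : ℝ), Z (φ s z)) = -((1 : ℝ), (0 : E)) + (0, Z (φ s z)) := by simp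
    rw [h9, map_add, map_neg, h7]
    simp
  have hc : Continuous fun s => κ (φ s z) := hκ.comp (h.continuous_time z)
  obtain ⟨C, hC⟩ := (isCompact_Icc (a := -(|t| + 1)) (b := |t| + 1)).exists_bound_of_continuousOn
    hc.continuousOn
  have hmem : ∀ r : ℝ, |r| ≤ |t| → r ∈ Set.Ioo (-(|t| + 1)) (|t| + 1) := fun r hr => by
    rw [Set.mem_Ioo, ← abs_lt]; linarith
  have h0 := ODE_solution_unique_of_mem_Ioo (v := fun s y => -b (φ s z) y)
    (s := fun _ => Set.univ) (K := C.toNNReal) (t₀ := t) (a := -(|t| + 1)) (b := |t| + 1)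
    (fun s hs => LipschitzOnWith.of_dist_le_mul fun v _ w _ => ?_) (hmem t le_rfl)
    (fun s _ => ⟨key hΓ s, trivial⟩) (fun s _ => ⟨key hΓ' s, trivial⟩) ?_ (hmem 0 (by simp))
  · simpa [h.zero] using h0
  · rw [dist_neg_neg, dist_eq_norm, dist_eq_norm]
    refine (hb _ _ _).trans (mul_le_mul_of_nonneg_right ?_ (norm_nonneg _))
    exact (le_abs_self _).trans ((hC s (Set.Ioo_subset_Icc_self hs)).trans (Real.le_coe_toNNReal C))
  · simp [hΓ.2.1, hΓ'.2.1]

end Transport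

namespace BRST

theorem opExp_eq {E F : Type*} [NormedAddCommGroup E] [NormedSpace ℝ E] [NormedAddCommGroup F]
    [NormedSpace ℝ F] {A : (E → F) → E → F} {g : E → F} (h : HasExp A g) {Γ : ℝ → E → F}
    (hΓ : IsExpOrbit A g Γ) : opExp A g = Γ 1 := by
  rw [opExp, dif_pos h, h.unique h.exists.choose_spec hΓ]

/-! ### The evolutions for a complete gauge flow -/

section Complete

variable {M N : Conf → ℝ}

theorem contDiff_liftField (hM : ContDiff ℝ ∞ M) (hN : ContDiff ℝ ∞ N) :
    ContDiff ℝ 1 (liftField M N) := by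
  have h : ∀ {P : Conf → ℝ} (i : Fin 2), ContDiff ℝ ∞ P →
      ContDiff ℝ 1 fun z : Conf × Mult => z.2 i * P z.1 := fun i hP => by
    have := hP.of_le (show (1 : WithTop ℕ∞) ≤ ∞ by simp)
    fun_prop
  refine ContDiff.prodMk (contDiff_pi.2 fun i => ?_) contDiff_const
  fin_cases i
  · simpa [gaugeField] using h 0 hM
  · simpa [gaugeField] using h 1 hN
  · simpa [gaugeField] using contDiff_const

theorem contDiff_halfDiv (hM : ContDiff ℝ ∞ M) (hN : ContDiff ℝ ∞ N) :
    ContDiff ℝ 1 (halfDiv M N) := by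
  have h : ∀ {P : Conf → ℝ} (i : Fin 3), ContDiff ℝ ∞ P → ContDiff ℝ 1 (pd i P) := fun i hP =>
    (hP.fderiv_right (m := 1) (by norm_cast)).clm_apply contDiff_const
  have h0 := h 0 hM
  have h1 := h 1 hN
  unfold halfDiv
  fun_prop

theorem continuous_fermOp (hM : ContDiff ℝ ∞ M) (hN : ContDiff ℝ ∞ N) (hMpos : ∀ q, 0 < M q)
    (hNpos : ∀ q, 0 < N q) : Continuous (fermOp M N) := by
  have hc : ∀ a, Continuous (coef M N a) := fun a => (contDiff_coef hM hN hMpos hNpos a).continuous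
  have hs : Continuous (trU M N) := by unfold trU; have := hc 0; have := hc 1; fun_prop
  have hu : ∀ a b, Continuous fun z : Conf × Mult => uMat M N z.1 z.2 a b := by
    intro a b
    simp only [uMat_eq, Matrix.of_apply]
    refine ((hc a).comp continuous_fst).mul ?_
    fin_cases b
    · simp only [Fin.zero_eta, Matrix.cons_val_zero]; fun_prop
    · simp only [Fin.mk_one, Matrix.cons_val_one, Matrix.cons_val_fin_one]; fun_prop
  unfold fermOp
  fun_prop

/-- A complete gauge flow, as a flow on the space of the `(q, λ)`. -/
theorem exists_globalFlow (h : ∀ l, CompleteField (gaugeField M N l)) :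
    ∃ γ : Mult → ℝ → Conf → Conf, (∀ l, IsGlobalFlow (gaugeField M N l) (γ l)) ∧
      IsGlobalFlow (liftField M N) fun t z => (γ z.2 t z.1, z.2) := by
  choose γ hγ using h
  refine ⟨fun l t q => γ l q t, fun l => ⟨fun q => (hγ l q).1, fun q => (hγ l q).2⟩,
    fun z => by simp [(hγ z.2 z.1).1], fun z t => ?_⟩
  exact ((hγ z.2 z.1).2 t).prodMk (hasDerivAt_const t z.2)

/-- The solution is the pullback of `χ` as a half density: `χ` along the flow, times the exponential
of the integrated half divergence. -/
theorem exists_isExpOrbit_iLamPhiJoint (hM : ContDiff ℝ ∞ M) (hN : ContDiff ℝ ∞ N)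
    (h : ∀ l, CompleteField (gaugeField M N l)) {χ : Conf → ℂ} (hχ : ContDiff ℝ ∞ χ) :
    ∃ Φ, IsExpOrbit (iLamPhiJoint M N) (fun z => χ z.1) Φ := by
  obtain ⟨γ, -, hγ⟩ := exists_globalFlow h
  have hg : ContDiff ℝ 1 fun z : Conf × Mult => χ z.1 :=
    (hχ.of_le (show (1 : WithTop ℕ∞) ≤ ∞ by simp)).comp contDiff_fst
  obtain ⟨h1, h2⟩ := hγ.hasDerivAt_transport (contDiff_liftField hM hN) (contDiff_halfDiv hM hN) hg
  refine ⟨fun t z => χ (γ z.2 t z.1)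
    * (Real.exp (flowIntegral (fun t z => (γ z.2 t z.1, z.2)) (halfDiv M N) t z) : ℂ),
    h1, ?_, fun t z => ?_⟩
  · ext z
    have h0 : γ z.2 0 z.1 = z.1 := congr_arg Prod.fst (hγ.zero z)
    simp [h0, flowIntegral]
  · refine (h2 t z).congr_deriv ?_
    rw [iLamPhiJoint_eq]
    have h3 : DifferentiableAt ℝ (fun z : Conf × Mult => (t, z)) z := by fun_prop
    exact (h1.differentiable one_ne_zero (t, z)).comp z h3

theorem isExpOrbit_iLamPhi {χ : Conf → ℂ} {Φ : ℝ → Conf × Mult → ℂ}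
    (hΦ : IsExpOrbit (iLamPhiJoint M N) (fun z => χ z.1) Φ) (l : Mult) :
    IsExpOrbit (iLamPhi M N l) χ fun t q => Φ t (q, l) := by
  obtain ⟨h1, h2, h3⟩ := hΦ
  refine ⟨?_, ?_, fun t q => h3 t (q, l)⟩
  · have : ContDiff ℝ 1 fun p : ℝ × Conf => (p.1, (p.2, l)) := by fun_prop
    exact h1.comp this
  · simp [h2]

/-- Existence comes from freezing `λ` in the joint solution. Uniqueness is argued at fixed `λ`,
since a competing solution is given for that one `λ` only. -/
theorem hasExp_iLamPhi (hM : ContDiff ℝ ∞ M) (hN : ContDiff ℝ ∞ N)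
    (h : ∀ l, CompleteField (gaugeField M N l)) {χ : Conf → ℂ} (hχ : ContDiff ℝ ∞ χ) (l : Mult) :
    HasExp (iLamPhi M N l) χ := by
  obtain ⟨Φ, hΦ⟩ := exists_isExpOrbit_iLamPhiJoint hM hN h hχ
  obtain ⟨γ, hγ, -⟩ := exists_globalFlow h
  refine ⟨_, isExpOrbit_iLamPhi hΦ l, fun Γ hΓ => ?_⟩
  refine (hγ l).isExpOrbit_unique (F := ℂ) (A := iLamPhi M N l) (g := χ) (b := fun q v => halfDiv M N (q, l) * v)
    (κ := fun q => ‖(halfDiv M N (q, l) : ℂ)‖) ?_ (fun q v w => ?_)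
    (fun Γ q _ => iLamPhi_eq l Γ q) hΓ (isExpOrbit_iLamPhi hΦ l)
  · have := (contDiff_halfDiv hM hN).continuous
    fun_prop
  · rw [← mul_sub, norm_mul]

theorem hasExp_iOmegaRho (hM : ContDiff ℝ ∞ M) (hN : ContDiff ℝ ∞ N) (hMpos : ∀ q, 0 < M q)
    (hNpos : ∀ q, 0 < N q) (hx : ∀ (a b c : Fin 2) (q q' : Conf), q 2 = q' 2 →
      structFn M N a b c q = structFn M N a b c q')
    (h : ∀ l, CompleteField (gaugeField M N l)) {χ : Conf → ℂ} (hχ : ContDiff ℝ ∞ χ) :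
    HasExp (iOmegaRho M N) (ghostFree χ) := by
  obtain ⟨Φ, hΦ⟩ := exists_isExpOrbit_iLamPhiJoint hM hN h hχ
  obtain ⟨γ, -, hγ⟩ := exists_globalFlow h
  have hΨ := isExpOrbit_smul_ghost hM hN hMpos hNpos hx hΦ
  refine ⟨_, hΨ, fun Γ hΓ => ?_⟩
  refine hγ.isExpOrbit_unique (b := fun z v => (halfDiv M N z : ℂ) • v + fermOp M N z v)
    (κ := fun z => ‖(halfDiv M N z : ℂ)‖ + ‖fermOp M N z‖) ?_ (fun z v w => ?_)
    (fun Γ z hz => iOmegaRho_eq hz) hΓ hΨ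
  · have := (contDiff_halfDiv hM hN).continuous
    have := continuous_fermOp hM hN hMpos hNpos
    fun_prop
  · rw [add_sub_add_comm, ← smul_sub, ← map_sub, add_mul]
    exact (norm_add_le _ _).trans
      (add_le_add (norm_smul_le _ _) (ContinuousLinearMap.le_opNorm _ _))

theorem neg_brstDensity_regState (hM : ContDiff ℝ ∞ M) (hN : ContDiff ℝ ∞ N)
    (hMpos : ∀ q, 0 < M q) (hNpos : ∀ q, 0 < N q)
    (hx : ∀ (a b c : Fin 2) (q q' : Conf), q 2 = q' 2 →
      structFn M N a b c q = structFn M N a b c q')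
    (h : ∀ l, CompleteField (gaugeField M N l)) (ψ : Conf → ℂ) {χ : Conf → ℂ}
    (hχ : ContDiff ℝ ∞ χ) (z : Conf × Mult) :
    -brstDensity (ghostFree ψ) (regState M N χ) z = avgDensity M N ψ χ z := by
  obtain ⟨Φ, hΦ⟩ := exists_isExpOrbit_iLamPhiJoint hM hN h hχ
  rw [regState, opExp_eq (hasExp_iOmegaRho hM hN hMpos hNpos hx h hχ)
    (isExpOrbit_smul_ghost hM hN hMpos hNpos hx hΦ), brstDensity_smul_ghost, avgDensity,
    opExp_eq (hasExp_iLamPhi hM hN h hχ z.2) (isExpOrbit_iLamPhi hΦ z.2)]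

end Complete

end BRST

/-! ### Measures with densities and changes of variables -/

section ChangeOfVariables

open scoped ENNReal

theorem MeasureTheory.Measure.map_withDensity_comp {α β : Type*} [MeasurableSpace α]
    [MeasurableSpace β] (μ : Measure α) {f : α → β} (hf : Measurable f) {g : β → ℝ≥0∞}
    (hg : Measurable g) :
    (μ.withDensity fun x => g (f x)).map f = (μ.map f).withDensity g := by
  ext s hs
  rw [Measure.map_apply hf hs, withDensity_apply _ (hf hs), withDensity_apply _ hs,
    setLIntegral_map hs hg hf]

/-- Change of variables for measures that are given by densities. -/
theorem MeasureTheory.Measure.map_restrict_withDensity_of_det {E : Type*} [NormedAddCommGroup E]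
    [NormedSpace ℝ E] [FiniteDimensional ℝ E] [MeasurableSpace E] [BorelSpace E] (μ : Measure E)
    [μ.IsAddHaarMeasure] {f : E → E} {f' : E → E →L[ℝ] E} {s t : Set E} (hs : MeasurableSet s)
    (hf : ∀ x, HasFDerivAt f (f' x) x) (hinj : Set.InjOn f s) (hst : f '' s = t)
    {a b : E → ℝ} (ha : Continuous fun x => (f' x).det) (hb : Measurable b)
    (hab : ∀ x ∈ s, a x = |(f' x).det| * b (f x)) :
    ((μ.restrict s).withDensity fun x => ENNReal.ofReal (a x)).map f
      = (μ.restrict t).withDensity fun x => ENNReal.ofReal (b x) := by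
  have hfm : Measurable f :=
    (continuous_iff_continuousAt.2 fun x => (hf x).continuousAt).measurable
  -- The density splits into the Jacobian, absorbed by the change of variables, and a function of `f
  -- x`, which passes through the push-forward.
  have h1 : ((μ.restrict s).withDensity fun x => ENNReal.ofReal (a x))
      = ((μ.restrict s).withDensity fun x => ENNReal.ofReal |(f' x).det|).withDensity
        fun x => ENNReal.ofReal (b (f x)) := by
    rw [← withDensity_mul _ ha.abs.measurable.ennreal_ofReal (by fun_prop)]
    refine withDensity_congr_ae ((ae_restrict_iff' hs).2 (.of_forall fun x hx => ?_))
    simp only [Pi.mul_apply]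
    rw [hab x hx, ENNReal.ofReal_mul (abs_nonneg _)]
  rw [h1, Measure.map_withDensity_comp _ hfm (g := fun y => ENNReal.ofReal (b y)) (by fun_prop),
    map_withDensity_abs_det_fderiv_eq_addHaar μ hs.nullMeasurableSet
      (fun x _ => (hf x).hasFDerivWithinAt) hinj, hst]

end ChangeOfVariables

namespace BRST

/-! ### The group law `v w = v + (1 + σ v) w` on a half plane -/

section Affine

variable (σ : Mult →L[ℝ] ℝ)

/-- The group law of the half plane `0 < 1 + σ v`. -/
noncomputable def affMul (v w : Mult) : Mult := v + (1 + σ v) • w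

/-- The exponential map of the half plane `0 < 1 + σ v`. -/
noncomputable def affExp (l : Mult) : Mult := expQuot (σ l) • l

/-- The inverse of the exponential map. -/
noncomputable def affLog (v : Mult) : Mult := (expQuot (Real.log (1 + σ v)))⁻¹ • v

/-- A left Haar measure of the half plane. -/
noncomputable def affMeasure : Measure Mult :=
  ((volume : Measure Mult).restrict {v | 0 < 1 + σ v}).withDensity
    fun v => ENNReal.ofReal ((1 + σ v) ^ 2)⁻¹

/-- A left Haar measure in exponential coordinates. -/
noncomputable def affExpMeasure : Measure Mult :=
  (volume : Measure Mult).withDensity fun l => ENNReal.ofReal (Real.exp (-σ l) * expQuot (σ l))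

variable {σ}

/-- The determinant of a rank-one perturbation of a scalar, in dimension two; it supplies all
Jacobians of this section. -/
theorem det_smul_id_add_smulRight (c : ℝ) (w : Mult) :
    (c • ContinuousLinearMap.id ℝ Mult + σ.smulRight w).det = c ^ 2 + c * σ w := by
  have hw : w = w 0 • Pi.single 0 1 + w 1 • Pi.single 1 1 := by
    ext i; fin_cases i <;> simp
  have hσ : σ w = w 0 * σ (Pi.single 0 1) + w 1 * σ (Pi.single 1 1) := by
    conv_lhs => rw [hw]
    simp
  rw [ContinuousLinearMap.det, ← LinearMap.det_toMatrix', Matrix.det_fin_two, hσ]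
  simp [LinearMap.toMatrix'_apply]
  ring

/-- So `1 + σ v` is multiplicative; it turns out to be the modular function. -/
theorem one_add_affMul (v w : Mult) : 1 + σ (affMul σ v w) = (1 + σ v) * (1 + σ w) := by
  simp [affMul]; ring

theorem one_add_affExp (l : Mult) : 1 + σ (affExp σ l) = Real.exp (σ l) := by
  have := mul_expQuot (σ l)
  simp [affExp]; linarith

theorem affExp_injective : Function.Injective (affExp σ) := by
  intro l l' h
  have hs : σ l = σ l' := Real.exp_injective (by rw [← one_add_affExp, ← one_add_affExp, h])
  simp only [affExp, hs] at h
  exact smul_right_injective _ (expQuot_pos _).ne' h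

theorem affLog_affExp (l : Mult) : affLog σ (affExp σ l) = l := by
  rw [affLog, one_add_affExp, Real.log_exp, affExp, smul_smul,
    inv_mul_cancel₀ (expQuot_pos _).ne', one_smul]

theorem affExp_affLog {v : Mult} (hv : 0 < 1 + σ v) : affExp σ (affLog σ v) = v := by
  have hs : σ (affLog σ v) = Real.log (1 + σ v) := by
    have h := mul_expQuot (Real.log (1 + σ v))
    rw [Real.exp_log hv] at h
    have := (expQuot_pos (Real.log (1 + σ v))).ne'
    simp only [affLog, map_smul, smul_eq_mul]
    field_simp
    linarith
  rw [affExp, hs, affLog, smul_smul, mul_inv_cancel₀ (expQuot_pos _).ne', one_smul]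

theorem continuous_affExp : Continuous (affExp σ) := by
  have := (contDiff_expQuot (n := 0)).continuous
  unfold affExp; fun_prop

theorem continuousOn_affLog : ContinuousOn (affLog σ) {v | 0 < 1 + σ v} := by
  have h := (contDiff_expQuot (n := 0)).continuous
  refine ContinuousOn.smul (ContinuousOn.inv₀ (h.comp_continuousOn
    (ContinuousOn.log (by fun_prop) fun v hv => ?_)) fun v _ => (expQuot_pos _).ne') continuousOn_id
  exact ne_of_gt hv

theorem measurableSet_half : MeasurableSet {v : Mult | 0 < 1 + σ v} :=
  (isOpen_lt continuous_const (by fun_prop)).measurableSet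

theorem image_affMul_left {v : Mult} (hv : 0 < 1 + σ v) :
    affMul σ v '' {w | 0 < 1 + σ w} = {w | 0 < 1 + σ w} := by
  ext w
  constructor
  · rintro ⟨w, hw, rfl⟩
    simp only [Set.mem_ofPred_eq, one_add_affMul] at hw ⊢
    positivity
  · intro hw
    have hw' : affMul σ v ((1 + σ v)⁻¹ • (w - v)) = w := by
      rw [affMul, smul_smul, mul_inv_cancel₀ hv.ne', one_smul]; abel
    refine ⟨_, ?_, hw'⟩
    have h : 0 < (1 + σ v) * (1 + σ ((1 + σ v)⁻¹ • (w - v))) := by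
      rw [← one_add_affMul, hw']; exact hw
    exact (pos_iff_pos_of_mul_pos h).1 hv

theorem image_affMul_right {w : Mult} (hw : 0 < 1 + σ w) :
    (fun v => affMul σ v w) '' {w | 0 < 1 + σ w} = {w | 0 < 1 + σ w} := by
  ext v
  constructor
  · rintro ⟨w, hw, rfl⟩
    simp only [Set.mem_ofPred_eq, one_add_affMul] at hw ⊢
    positivity
  · intro hv
    -- The inverse of `w` for the group law is `-(1 + σ w)⁻¹ • w`.
    have hv' : affMul σ (affMul σ v (-(1 + σ w)⁻¹ • w)) w = v := by
      have := hw.ne'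
      ext i; simp [affMul]; field_simp; ring
    refine ⟨_, ?_, hv'⟩
    have h : 0 < (1 + σ (affMul σ v (-(1 + σ w)⁻¹ • w))) * (1 + σ w) := by
      rw [← one_add_affMul, hv']; exact hv
    exact (pos_iff_pos_of_mul_pos h).2 hw

theorem measurable_affDensity : Measurable fun v : Mult => ((1 + σ v) ^ 2)⁻¹ := by fun_prop

/-- Left translation has linear part `(1 + σ v) • id`, whose determinant `(1 + σ v)²` is what the
density compensates. -/
theorem map_affMul_left {v : Mult} (hv : 0 < 1 + σ v) :
    (affMeasure σ).map (affMul σ v) = affMeasure σ := by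
  have hd : ((1 + σ v) • ContinuousLinearMap.id ℝ Mult).det = (1 + σ v) ^ 2 := by
    simpa using det_smul_id_add_smulRight (σ := σ) (1 + σ v) 0
  refine Measure.map_restrict_withDensity_of_det volume
    (f' := fun _ => (1 + σ v) • ContinuousLinearMap.id ℝ Mult) measurableSet_half (fun w => ?_)
    (fun w _ w' _ h => ?_) (image_affMul_left hv) continuous_const measurable_affDensity
    fun w _ => ?_
  · exact ((hasFDerivAt_id w).const_smul (1 + σ v)).const_add v
  · exact smul_right_injective _ hv.ne' (add_left_cancel h)
  · rw [hd, one_add_affMul, abs_of_pos (by positivity), mul_pow, mul_inv,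
      mul_inv_cancel_left₀ (by positivity)]

/-- Right translation has Jacobian `1 + σ w`, only one of the two factors in the density; the other
remains as the modular function. -/
theorem map_affMul_right {w : Mult} (hw : 0 < 1 + σ w) :
    (affMeasure σ).map (fun v => affMul σ v w) = ENNReal.ofReal (1 + σ w) • affMeasure σ := by
  have hd : (ContinuousLinearMap.id ℝ Mult + σ.smulRight w).det = 1 + σ w := by
    simpa using det_smul_id_add_smulRight (σ := σ) 1 w
  have hr : ENNReal.ofReal (1 + σ w) • affMeasure σ
      = ((volume : Measure Mult).restrict {v | 0 < 1 + σ v}).withDensity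
        fun v => ENNReal.ofReal ((1 + σ w) * ((1 + σ v) ^ 2)⁻¹) := by
    rw [affMeasure, ← withDensity_smul _ (by fun_prop)]
    congr 1; ext v
    simp only [Pi.smul_apply, smul_eq_mul, ENNReal.ofReal_mul hw.le]
  rw [hr]
  refine Measure.map_restrict_withDensity_of_det volume
    (f' := fun _ => ContinuousLinearMap.id ℝ Mult + σ.smulRight w) measurableSet_half
    (fun v => ?_) (fun v hv v' hv' h => ?_) (image_affMul_right hw) continuous_const (by fun_prop)
    fun v _ => ?_
  · exact (hasFDerivAt_id v).add ((σ.hasFDerivAt.const_add 1).smul_const w)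
  · have hs : 1 + σ v = 1 + σ v' := by
      have := congrArg (fun v => 1 + σ v) h
      simp only [one_add_affMul] at this
      exact mul_right_cancel₀ hw.ne' this
    simp only [affMul, hs] at h
    exact add_right_cancel h
  · have := hw.ne'
    rw [hd, one_add_affMul, abs_of_pos hw, mul_pow, mul_inv]
    field_simp

/-- With `s = σ l` the Jacobian is `expQuot s * (expQuot s + s * expQuot' s) = expQuot s * e^s`, and
the density of `affMeasure` contributes `e^{-2s}`. -/
theorem map_affExp : (affExpMeasure σ).map (affExp σ) = affMeasure σ := by
  have he := (contDiff_expQuot (n := 1))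
  have hd : ∀ l, (expQuot (σ l) • ContinuousLinearMap.id ℝ Mult
      + σ.smulRight (deriv expQuot (σ l) • l)).det = expQuot (σ l) * Real.exp (σ l) := fun l => by
    rw [det_smul_id_add_smulRight, ← expQuot_add_mul_deriv]
    simp; ring
  rw [affExpMeasure, ← Measure.restrict_univ (μ := (volume : Measure Mult))]
  refine Measure.map_restrict_withDensity_of_det volume MeasurableSet.univ
    (f' := fun l => expQuot (σ l) • ContinuousLinearMap.id ℝ Mult
      + σ.smulRight (deriv expQuot (σ l) • l)) (fun l => ?_)
    (affExp_injective.injOn) ?_ ?_ measurable_affDensity fun l _ => ?_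
  · have h := ((hasDerivAt_expQuot (σ l)).comp_hasFDerivAt l σ.hasFDerivAt).smul (hasFDerivAt_id l)
    refine h.congr_fderiv ?_
    ext m i
    simp; ring
  · ext v
    constructor
    · rintro ⟨l, -, rfl⟩
      simpa [one_add_affExp] using Real.exp_pos _
    · exact fun hv => ⟨affLog σ v, trivial, affExp_affLog hv⟩
  · simp only [hd]
    have := he.continuous
    fun_prop
  · have := expQuot_pos (σ l)
    rw [hd, one_add_affExp, abs_of_pos (by positivity), Real.exp_neg]
    field_simp

/-- A group with the law of the half plane has the symmetric measure
`exp (-σ l / 2) expQuot (σ l) dl` in exponential coordinates. -/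
theorem isSymmetricHaar_of_affine {G : Type*} [Group G] [TopologicalSpace G] [MeasurableSpace G]
    [BorelSpace G] [IsTopologicalGroup G] (e : Mult ≃ₜ G) (P : G → Mult)
    (hP : ∀ l, P (e l) = affExp σ l) (hmul : ∀ g h, P (g * h) = affMul σ (P g) (P h)) :
    IsSymmetricHaar (Measure.map e ((volume : Measure Mult).withDensity
      fun l => ENNReal.ofReal (Real.exp (-(σ l / 2)) * expQuot (σ l)))) := by
  have hc := (contDiff_expQuot (n := 0)).continuous
  have hPe : P = affExp σ ∘ e.symm := funext fun g => by
    conv_lhs => rw [← e.apply_symm_apply g, hP]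
    rfl
  have hPcont : Continuous P := hPe ▸ continuous_affExp.comp e.symm.continuous
  have hPemb : MeasurableEmbedding P := hPe ▸
    (continuous_affExp.measurableEmbedding affExp_injective).comp e.symm.measurableEmbedding
  have hem : Measurable e := e.continuous.measurable
  have hΔ : ∀ l, 1 + σ (P (e l)) = Real.exp (σ l) := fun l => by rw [hP, one_add_affExp]
  have hpos : ∀ g, 0 < 1 + σ (P g) := fun g => by
    rw [← e.apply_symm_apply g, hΔ]; exact Real.exp_pos _
  have hmap : ((affExpMeasure σ).map e).map P = affMeasure σ := by
    rw [Measure.map_map hPemb.measurable hem, ← map_affExp]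
    congr 1; exact funext hP
  -- As `P` is a measurable embedding, invariance on `G` may be checked in the half plane.
  have hext : ∀ μ μ' : Measure G, μ.map P = μ'.map P → μ = μ' := fun μ μ' h => by
    rw [← hPemb.comap_map μ, h, hPemb.comap_map]
  have hloc : IsLocallyFiniteMeasure (affExpMeasure σ) :=
    IsLocallyFiniteMeasure.withDensity_ofReal (by fun_prop)
  have hop : (affExpMeasure σ).IsOpenPosMeasure :=
    (withDensity_absolutelyContinuous' (by fun_prop) (.of_forall fun l => by
      have := expQuot_pos (σ l)
      have : 0 < Real.exp (-σ l) * expQuot (σ l) := by positivity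
      simpa using this)).isOpenPosMeasure
  refine ⟨(affExpMeasure σ).map e, fun g => 1 + σ (P g),
    { lt_top_of_isCompact := fun K hK => ?_
      map_mul_left_eq_self := fun g => hext _ _ ?_
      toIsOpenPosMeasure := e.continuous.isOpenPosMeasure_map e.surjective },
    fun h => ⟨hpos h, hext _ _ ?_⟩, ?_⟩
  · have : T2Space G := e.t2Space
    rw [Measure.map_apply hem hK.measurableSet]
    exact (e.isCompact_preimage.2 hK).measure_lt_top
  · have hcm : Measurable (affMul σ (P g)) := by unfold affMul; fun_prop
    rw [Measure.map_map hPemb.measurable (continuous_const_mul g).measurable, hmap]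
    conv_rhs => rw [← map_affMul_left (hpos g), ← hmap, Measure.map_map hcm hPemb.measurable]
    congr 1; exact funext (hmul g)
  · have hcm : Measurable (fun v => affMul σ v (P h)) := by unfold affMul; fun_prop
    rw [Measure.map_map hPemb.measurable (continuous_mul_const h).measurable, Measure.map_smul, hmap,
      ← map_affMul_right (hpos h)]
    conv_rhs => rw [← hmap, Measure.map_map hcm hPemb.measurable]
    congr 1; exact funext fun g => hmul g h
  -- In exponential coordinates `√Δ = e^{s/2}`, which turns `e^{-s} expQuot s` into `e^{-s/2}
  -- expQuot s`.
  · have hs : Measurable fun g => ENNReal.ofReal √(1 + σ (P g)) := by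
      have := hPemb.measurable
      fun_prop
    have hs' : Measurable fun l => ENNReal.ofReal √(1 + σ (P (e l))) := hs.comp hem
    rw [← Measure.map_withDensity_comp _ hem hs, affExpMeasure,
      ← withDensity_mul _ (by fun_prop) hs']
    congr 2; ext l
    have := expQuot_pos (σ l)
    simp only [Pi.mul_apply]
    rw [hΔ, ← ENNReal.ofReal_mul (by positivity), ← Real.exp_half, mul_right_comm, ← Real.exp_add]
    ring_nf

end Affine
end BRST

namespace BRST

/-! ### The gauge group in the adjoint representation -/

section AdjointGroup

variable (M N : Conf → ℝ) (q : Conf)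

/-- The trace of `u(q, λ)` as a linear form in `λ`. -/
noncomputable def trForm : Mult →L[ℝ] ℝ :=
  coef M N 1 q • ContinuousLinearMap.proj 0 - coef M N 0 q • ContinuousLinearMap.proj 1

/-- The `v` with `A = 1 + u(q, v)`, if there is one. -/
noncomputable def adCoord (A : Matrix (Fin 2) (Fin 2) ℝ) : Mult :=
  (coef M N 0 q ^ 2 + coef M N 1 q ^ 2)⁻¹ •
    ![coef M N 0 q * A 0 1 + coef M N 1 q * (A 1 1 - 1),
      -(coef M N 0 q * (A 0 0 - 1) + coef M N 1 q * A 1 0)]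

variable {M N q}

theorem trForm_apply (l : Mult) : trForm M N q l = trU M N (q, l) := by
  simp [trForm, trU]

theorem uMat_smul (c : ℝ) (l : Mult) : uMat M N q (c • l) = c • uMat M N q l := by
  ext a b
  simp only [uMat_eq]
  fin_cases b <;> simp <;> ring

theorem uMat_zero : uMat M N q 0 = 0 := by simpa using uMat_smul (q := q) 0 0

theorem continuous_uMat : Continuous (uMat M N q) := by
  refine continuous_matrix fun a b => ?_
  simp only [uMat, Matrix.of_apply]
  fun_prop

theorem coe_expGL (l : Mult) :
    (expGL (uMat M N q l) : Matrix (Fin 2) (Fin 2) ℝ) = 1 + uMat M N q (affExp (trForm M N q) l) := by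
  rw [affExp, uMat_smul, trForm_apply]
  exact Matrix.exp_of_mul_self (uMat_mul_self q l)

/-- The rank-one form gives `u(v) u(w) = σ(v) u(w)` with `σ` the trace form. -/
theorem one_add_uMat_mul (v w : Mult) : (1 + uMat M N q v) * (1 + uMat M N q w)
    = 1 + uMat M N q (affMul (trForm M N q) v w) := by
  ext a b
  simp only [uMat_eq, affMul, trForm_apply, trU, Matrix.mul_apply, Fin.sum_univ_two]
  fin_cases a <;> fin_cases b <;> simp <;> ring

theorem expGL_neg (l : Mult) : (expGL (uMat M N q l))⁻¹ = expGL (uMat M N q (-l)) := by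
  refine inv_eq_of_mul_eq_one_right (Units.ext ?_)
  have h : affMul (trForm M N q) (affExp (trForm M N q) l) (affExp (trForm M N q) (-l)) = 0 := by
    rw [affMul, one_add_affExp, affExp, affExp, map_neg, expQuot_neg, Real.exp_neg, smul_smul,
      mul_inv_cancel_left₀ (Real.exp_pos _).ne', smul_neg, add_neg_cancel]
  rw [Units.val_mul, coe_expGL, coe_expGL, one_add_uMat_mul, h, uMat_zero, add_zero, Units.val_one]

theorem expGL_mul (l l' : Mult) : ∃ m, expGL (uMat M N q m)
    = expGL (uMat M N q l) * expGL (uMat M N q l') := by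
  refine ⟨affLog (trForm M N q) (affMul (trForm M N q) (affExp (trForm M N q) l)
    (affExp (trForm M N q) l')), Units.ext ?_⟩
  rw [Units.val_mul, coe_expGL, coe_expGL, coe_expGL, one_add_uMat_mul, affExp_affLog]
  rw [one_add_affMul, one_add_affExp, one_add_affExp]
  positivity

/-- Products and inverses of exponentials are again exponentials, so these already form the
generated subgroup. -/
theorem adjointExp_surjective : Function.Surjective (adjointExp M N q) := by
  rintro ⟨g, hg⟩
  suffices h : ∃ l, expGL (uMat M N q l) = g from h.imp fun l hl => Subtype.ext hl
  refine Subgroup.closure_induction (p := fun g _ => ∃ l, expGL (uMat M N q l) = g)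
    ?_ ⟨0, Units.ext ?_⟩ ?_ ?_ hg
  · rintro _ ⟨l, rfl⟩
    exact ⟨l, rfl⟩
  · rw [coe_expGL]
    simp [affExp, uMat_zero]
  · rintro _ _ _ _ ⟨l, rfl⟩ ⟨l', rfl⟩
    exact expGL_mul l l'
  · rintro _ _ ⟨l, rfl⟩
    exact ⟨-l, (expGL_neg l).symm⟩

/-- Contracting `u = α ⊗ (-v², v¹)` with `α / |α|²` recovers `v`; this requires `α ≠ 0`. -/
theorem adCoord_one_add (h : coef M N 0 q ^ 2 + coef M N 1 q ^ 2 ≠ 0) (v : Mult) :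
    adCoord M N q (1 + uMat M N q v) = v := by
  ext b
  fin_cases b <;> simp [adCoord, uMat_eq] <;> field_simp
  ring

theorem adCoord_expGL (h : coef M N 0 q ^ 2 + coef M N 1 q ^ 2 ≠ 0) (l : Mult) :
    adCoord M N q (expGL (uMat M N q l)) = affExp (trForm M N q) l := by
  rw [coe_expGL, adCoord_one_add h]

theorem continuous_adCoord : Continuous (adCoord M N q) := by
  refine continuous_pi fun b => ?_
  fin_cases b <;> simp [adCoord] <;> fun_prop

theorem continuous_adjointExp : Continuous (adjointExp M N q) := by
  have h : Continuous fun l => (expGL (uMat M N q l) : Matrix (Fin 2) (Fin 2) ℝ) := by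
    simp only [coe_expGL]
    exact continuous_const.add (continuous_uMat.comp continuous_affExp)
  -- The topology of the units also asks for continuity of the inverse, which is the exponential at
  -- `-λ`.
  refine Continuous.subtype_mk (Units.continuous_iff.2 ⟨h, ?_⟩) _
  simp only [expGL_neg]
  exact h.comp continuous_neg

instance : BorelSpace (adjointGroup M N q) := ⟨rfl⟩

/-- Exponential coordinates on the gauge group, for a structure that is not unimodular. -/
noncomputable def adjointHomeomorph (h : coef M N 0 q ^ 2 + coef M N 1 q ^ 2 ≠ 0) :
    Mult ≃ₜ adjointGroup M N q where
  toFun := adjointExp M N q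
  invFun g := affLog (trForm M N q) (adCoord M N q g.1)
  left_inv l := by
    change affLog _ (adCoord M N q (expGL (uMat M N q l))) = l
    rw [adCoord_expGL h, affLog_affExp]
  right_inv g := by
    obtain ⟨l, rfl⟩ := adjointExp_surjective g
    change adjointExp M N q (affLog _ (adCoord M N q (expGL (uMat M N q l)))) = _
    rw [adCoord_expGL h, affLog_affExp]
  continuous_toFun := continuous_adjointExp
  continuous_invFun := by
    refine continuousOn_affLog.comp_continuous (continuous_adCoord.comp
      (Units.continuous_val.comp continuous_subtype_val)) fun g => ?_
    obtain ⟨l, rfl⟩ := adjointExp_surjective g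
    change 0 < 1 + trForm M N q (adCoord M N q (expGL (uMat M N q l)))
    rw [adCoord_expGL h, one_add_affExp]
    exact Real.exp_pos _

theorem isSymmetricHaar_map_adjointExp (h : coef M N 0 q ^ 2 + coef M N 1 q ^ 2 ≠ 0) :
    IsSymmetricHaar (Measure.map (adjointExp M N q) ((volume : Measure Mult).withDensity
      fun l => ENNReal.ofReal (j0 (uMat M N q l)))) := by
  have := isSymmetricHaar_of_affine (adjointHomeomorph h) (fun g => adCoord M N q g.1)
    (σ := trForm M N q) (fun l => adCoord_expGL h l) fun g g' => by
      obtain ⟨l, rfl⟩ := adjointExp_surjective g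
      obtain ⟨l', rfl⟩ := adjointExp_surjective g'
      change adCoord M N q ((expGL (uMat M N q l) : Matrix (Fin 2) (Fin 2) ℝ)
        * expGL (uMat M N q l')) = affMul _ (adCoord M N q (expGL (uMat M N q l)))
          (adCoord M N q (expGL (uMat M N q l')))
      rw [adCoord_expGL h, adCoord_expGL h, coe_expGL, coe_expGL, one_add_uMat_mul,
        adCoord_one_add h]
  simp only [trForm_apply, ← j0_uMat] at this
  exact this

end AdjointGroup

end BRST

/-! ### Assembly of the theorem -/

theorem mainTheorem2 (M N : BRST.Conf → ℝ)
    (hM : ContDiff ℝ ∞ M) (hN : ContDiff ℝ ∞ N)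
    (hMpos : ∀ q, 0 < M q) (hNpos : ∀ q, 0 < N q)
    (hx : ∀ (a b c : Fin 2) (q q' : BRST.Conf), q 2 = q' 2 →
      BRST.structFn M N a b c q = BRST.structFn M N a b c q') :
    -- classical solutions of the two evolutions, whether or not the gauge flow is complete
    (∀ χ : BRST.Conf → ℂ, ContDiff ℝ ∞ χ → ∀ Φ : ℝ → BRST.Conf × BRST.Mult → ℂ,
      BRST.IsExpOrbit (BRST.iLamPhiJoint M N) (fun z => χ z.1) Φ →
      ∃ Ψ : ℝ → BRST.Wave,
        BRST.IsExpOrbit (BRST.iOmegaRho M N) (BRST.ghostFree χ) Ψ ∧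
        ∀ (ψ : BRST.Conf → ℂ) (z : BRST.Conf × BRST.Mult),
          -BRST.brstDensity (BRST.ghostFree ψ) (Ψ 1) z
            = (BRST.j0 (BRST.uMat M N z.1 z.2) : ℂ) * (starRingEnd ℂ) (ψ z.1) * Φ 1 z) ∧
    -- for a complete gauge flow, the exponentials are well defined
    -- and the regularised form reduces to the averaging formula
    ((∀ l : BRST.Mult, BRST.CompleteField (BRST.gaugeField M N l)) →
      ∀ ψ χ : BRST.Conf → ℂ, ContDiff ℝ ∞ ψ → ContDiff ℝ ∞ χ →
      BRST.HasExp (BRST.iOmegaRho M N) (BRST.ghostFree χ) ∧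
      (∀ l : BRST.Mult, BRST.HasExp (BRST.iLamPhi M N l) χ) ∧
      (∀ z : BRST.Conf × BRST.Mult,
        -BRST.brstDensity (BRST.ghostFree ψ) (BRST.regState M N χ) z
          = BRST.avgDensity M N ψ χ z) ∧
      (Integrable (BRST.brstDensity (BRST.ghostFree ψ) (BRST.regState M N χ)) ↔
        Integrable (BRST.avgDensity M N ψ χ)) ∧
      BRST.regForm M N ψ χ = ∫ z : BRST.Conf × BRST.Mult, BRST.avgDensity M N ψ χ z) ∧
    -- the measure is positive and gauge invariant
    (∀ (q : BRST.Conf) (l : BRST.Mult), 0 < BRST.j0 (BRST.uMat M N q l)) ∧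
    (∀ (q q' : BRST.Conf) (l : BRST.Mult), q 2 = q' 2 →
      BRST.j0 (BRST.uMat M N q l) = BRST.j0 (BRST.uMat M N q' l)) ∧
    -- unimodular points
    (∀ q : BRST.Conf, (∀ a : Fin 2, ∑ b, BRST.structFn M N a b b q = 0) →
      ∀ l : BRST.Mult, BRST.j0 (BRST.uMat M N q l) = 1) ∧
    -- points with non-unimodular gauge group, in particular non-unimodular structure constants
    (∀ q : BRST.Conf, (∃ a : Fin 2, ∑ b, BRST.structFn M N a b b q ≠ 0) →
      Function.Bijective (BRST.adjointExp M N q) ∧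
      BRST.IsSymmetricHaar (Measure.map (BRST.adjointExp M N q)
        ((volume : Measure BRST.Mult).withDensity
          fun l => ENNReal.ofReal (BRST.j0 (BRST.uMat M N q l))))) := by
  refine ⟨fun χ _ Φ hΦ => ⟨fun t z => Φ t z • BRST.ghost M N t z,
    BRST.isExpOrbit_smul_ghost hM hN hMpos hNpos hx hΦ, fun ψ z => ?_⟩, fun h ψ χ _ hχ => ?_,
    BRST.j0_uMat_pos, fun q q' l hq => ?_, fun q h l => BRST.j0_uMat_of_unimodular h l,
    fun q h => ?_⟩
  · exact BRST.brstDensity_smul_ghost ψ (Φ 1) z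
  · have hd : BRST.brstDensity (BRST.ghostFree ψ) (BRST.regState M N χ)
        = -BRST.avgDensity M N ψ χ := funext fun z => by
      rw [Pi.neg_apply, ← BRST.neg_brstDensity_regState hM hN hMpos hNpos hx h ψ hχ z, neg_neg]
    refine ⟨BRST.hasExp_iOmegaRho hM hN hMpos hNpos hx h hχ,
      fun l => BRST.hasExp_iLamPhi hM hN h hχ l,
      BRST.neg_brstDensity_regState hM hN hMpos hNpos hx h ψ hχ, ?_, ?_⟩
    · rw [hd, integrable_neg_iff]
    · simp only [BRST.regForm, BRST.brstForm, hd, Pi.neg_apply, integral_neg]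
      ring
  · have hu : BRST.uMat M N q l = BRST.uMat M N q' l := by
      ext a b
      simp only [BRST.uMat, Matrix.of_apply, hx _ _ _ q q' hq]
    rw [hu]
  -- The traces `f_{1b}^b` and `f_{2b}^b` are `α²` and `-α¹` (upper indices), so a non-unimodular
  -- point is one with `α ≠ 0`.
  · have hc : BRST.coef M N 0 q ^ 2 + BRST.coef M N 1 q ^ 2 ≠ 0 := by
      obtain ⟨a, ha⟩ := h
      have h0 := sq_nonneg (BRST.coef M N 0 q)
      have h1 := sq_nonneg (BRST.coef M N 1 q)
      fin_cases a
      · rw [Fin.zero_eta, BRST.sum_structFn_zero] at ha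
        positivity
      · rw [Fin.mk_one, BRST.sum_structFn_one] at ha
        have ha' : BRST.coef M N 0 q ≠ 0 := neg_ne_zero.1 ha
        positivity
    exact ⟨(BRST.adjointHomeomorph hc).bijective, BRST.isSymmetricHaar_map_adjointExp hc⟩
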